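/- Let $\mathcal{N}\subset\mathcal{B}(H)$ be a von Neumann algebra with a faithful normal tracial state $\tau$, and let $\mathcal{N}_0\subset\mathcal{N}_1\subset\mathcal{N}_2\subset\cdots$ be an increasing sequence of von Neumann subalgebras of $\mathcal{N}$ (with the same unit). Let $f\in L_1(\mathcal{N},\tau)_+$, that is, $f$ is a (possibly unbounded) positive self-adjoint operator affiliated with $\mathcal{N}$ with $\tau(f)=\sup_k\tau\big(f\,\mathbf{1}_{[0,k]}(f)\big)<\infty$. Let $f_n=\mathbf{E}_n(f)\in L_1(\mathcal{N}_n,\tau)_+$ be its conditional expectation onto $\mathcal{N}_n$, the unique element with $\tau(f_n x)=\tau(f x)$ for all $0\le x\in\mathcal{N}_n$. For $\lambda>0$ let Cuculescu's projections be given by \[ q_0(\lambda)=\mathbf{1},\qquad q_{n}(\lambda)=q_{n-1}(\lambda)\,\mathbf{1}_{[0,\lambda]}\big(q_{n-1}(\lambda)\,f_n\,q_{n-1}(\lambda)\big)\quad(n\ge 1),\qquad q(\lambda)=\bigwedge_{n\ge 0}q_n(\lambda), \] where $q_{n-1}(\lambda)f_nq_{n-1}(\lambda)$ is the product of measurable operators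 (the closure of the algebraic product). Then $\mathbf{1}-q(\lambda)\in\mathcal{N}$ and \[ \tau\big(\mathbf{1}-q(\lambda)\big)\;\le\;\frac{2}{\lambda}\,\tau\Big(f\,\mathbf{1}_{(\frac{\lambda}{2},\infty)}(f)\Big). \] -/

import Mathlib

open scoped ENNReal ComplexOrder

noncomputable section

namespace NCMart

variable {H : Type*} [NormedAddCommGroup H] [InnerProductSpace ℂ H] [CompleteSpace H]

/-- The weak-* (ultraweak) topology of `B(H)`: the coarsest topology for which all functionals
`x ↦ ∑ i, ⟪ξ i, x (η i)⟫`, with `ξ`, `η` square-summable sequences of vectors, are continuous. -/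
@[reducible] def ultraweakTopology (H : Type*) [NormedAddCommGroup H] [InnerProductSpace ℂ H]
    [CompleteSpace H] : TopologicalSpace (H →L[ℂ] H) :=
  ⨅ (ξ : lp (fun _ : ℕ => H) 2) (η : lp (fun _ : ℕ => H) 2),
    TopologicalSpace.induced (fun x : H →L[ℂ] H => ∑' i, inner ℂ (ξ i) (x (η i))) inferInstance

/-- A faithful normal tracial state on the von Neumann algebra `N`. -/
structure TracialState (N : VonNeumannAlgebra H) where
  toLinearMap : N.toStarSubalgebra →ₗ[ℂ] ℂ
  map_one' : toLinearMap 1 = 1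
  nonneg' : ∀ x, 0 ≤ toLinearMap (star x * x)
  faithful' : ∀ x, toLinearMap (star x * x) = 0 → x = 0
  tracial' : ∀ x y, toLinearMap (x * y) = toLinearMap (y * x)
  normal' : @Continuous _ _ (TopologicalSpace.induced Subtype.val (ultraweakTopology H))
    inferInstance toLinearMap

open Classical in
/-- `Re τ(a)` for an operator `a` that belongs to `N` (and `0` for `a ∉ N`). -/
def TracialState.re {N : VonNeumannAlgebra H} (τ : TracialState N) (a : H →L[ℂ] H) : ℝ :=
  if h : a ∈ N.toStarSubalgebra then (τ.toLinearMap ⟨a, h⟩).re else 0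

/-- The orthogonal projection onto (the closure of) a subspace. -/
def proj (K : Submodule ℂ H) : H →L[ℂ] H := K.topologicalClosure.starProjection

/-- `R` is the bounded inverse `(1 + T)⁻¹` of `1 + T`. There is at most one such `R`. -/
def IsResolvent (T : H →ₗ.[ℂ] H) (R : H →L[ℂ] H) : Prop :=
  (∀ y : H, ∃ hy : R y ∈ T.domain, R y + T ⟨R y, hy⟩ = y) ∧
    ∀ x : T.domain, R ((x : H) + T x) = x

open Classical in
/-- The bounded operator `(1 + T)⁻¹`; it exists for every positive self-adjoint `T`. -/
def resolvent (T : H →ₗ.[ℂ] H) : H →L[ℂ] H :=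
  if h : ∃ R, IsResolvent T R then h.choose else 0

/-- The spectral projection `1_{[0,s]}(T)` of a positive self-adjoint operator `T`, for `s ≥ 0`.
With `R = (1 + T)⁻¹` it is `1_{[c,1]}(R)`, where `c = 1 / (1 + s)`, that is, the
projection onto the kernel of the operator `(c - R)₊` given by the continuous functional
calculus of the bounded self-adjoint operator `R`. -/
def spectralLE (T : H →ₗ.[ℂ] H) (s : ℝ) : H →L[ℂ] H :=
  proj (LinearMap.ker (cfc (fun r : ℝ => max ((1 + s)⁻¹ - r) 0) (resolvent T)).toLinearMap)

/-- The spectral projection `1_{(s,∞)}(T)` of a positive self-adjoint operator `T`, `s ≥ 0`. -/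
def spectralGT (T : H →ₗ.[ℂ] H) (s : ℝ) : H →L[ℂ] H := 1 - spectralLE T s

open Classical in
/-- The bounded operator `T 1_{[0,s]}(T)`, for `T` positive and self-adjoint. -/
def truncation (T : H →ₗ.[ℂ] H) (s : ℝ) : H →L[ℂ] H :=
  if h : ∃ a : H →L[ℂ] H, ∀ x, ∃ hx : spectralLE T s x ∈ T.domain,
    a x = T ⟨spectralLE T s x, hx⟩ then h.choose else 0

/-- The trace `τ(T x) ∈ [0,∞]` for a positive self-adjoint operator `T` affiliated with `N` and
`0 ≤ x ∈ N`: the supremum (increasing limit) of `τ(T 1_{[0,k]}(T) x)` over `k = 0, 1, 2, …`. -/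
def TracialState.traceMul {N : VonNeumannAlgebra H} (τ : TracialState N) (T : H →ₗ.[ℂ] H)
    (x : H →L[ℂ] H) : ℝ≥0∞ :=
  ⨆ k : ℕ, ENNReal.ofReal (τ.re (truncation T k * x))

/-- `T` is affiliated with `M`: it commutes with all elements of the commutant of `M`. -/
def Affiliated (M : VonNeumannAlgebra H) (T : H →ₗ.[ℂ] H) : Prop :=
  ∀ u ∈ M.commutant, ∀ x : T.domain, ∃ hx : u x ∈ T.domain, T ⟨u x, hx⟩ = u (T x)

/-- `f ∈ L₁(M, τ)₊`, for a von Neumann subalgebra `M` of `N`: `f` is a (possibly unbounded)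
positive self-adjoint operator affiliated with `M`, with `τ(f) < ∞`. -/
structure TracialState.MemL1Pos {N : VonNeumannAlgebra H} (τ : TracialState N)
    (M : VonNeumannAlgebra H) (f : H →ₗ.[ℂ] H) : Prop where
  isSelfAdjoint : IsSelfAdjoint f
  nonneg : ∀ x : f.domain, 0 ≤ (inner ℂ (f x) (x : H)).re
  affiliated : Affiliated M f
  trace_lt_top : τ.traceMul f 1 < ∞

/-- `g` is the conditional expectation of `f ∈ L₁(N, τ)₊` onto `M ≤ N`: it is the element of
`L₁(M, τ)₊` with `τ(g x) = τ(f x)` for all `x ∈ M₊`. -/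
def TracialState.IsCondExp {N : VonNeumannAlgebra H} (τ : TracialState N)
    (M : VonNeumannAlgebra H) (f g : H →ₗ.[ℂ] H) : Prop :=
  τ.MemL1Pos M g ∧ ∀ x ∈ M, 0 ≤ x → τ.traceMul g x = τ.traceMul f x

open Classical in
/-- The conditional expectation of `f ∈ L₁(N, τ)₊` onto `M ≤ N`; it exists and is unique. -/
def TracialState.condExp {N : VonNeumannAlgebra H} (τ : TracialState N)
    (M : VonNeumannAlgebra H) (f : H →ₗ.[ℂ] H) : H →ₗ.[ℂ] H :=
  if h : ∃ g, τ.IsCondExp M f g then h.choose else 0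

/-- The algebraic product `q f q`, on its natural domain `{x | q x ∈ dom f}`. -/
def algCompress (q : H →L[ℂ] H) (f : H →ₗ.[ℂ] H) : H →ₗ.[ℂ] H where
  domain := f.domain.comap q.toLinearMap
  toFun := q.toLinearMap ∘ₗ f.toFun ∘ₗ
    (q.toLinearMap.restrict (p := f.domain.comap q.toLinearMap) (q := f.domain) fun _ hx => hx)

/-- The product `q f q` of measurable operators: the closure of the algebraic product. -/
def compress (q : H →L[ℂ] H) (f : H →ₗ.[ℂ] H) : H →ₗ.[ℂ] H := (algCompress q f).closure

/-- Cuculescu's projections of a sequence `(f n)` of positive operators at height `s`: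
`q 0 = 1` and `q (n+1) = q n * 1_{[0,s]}(q n * f (n+1) * q n)`. -/
def cuculescuSeq (f : ℕ → H →ₗ.[ℂ] H) (s : ℝ) : ℕ → H →L[ℂ] H
  | 0 => 1
  | n + 1 => cuculescuSeq f s n * spectralLE (compress (cuculescuSeq f s n) (f (n + 1))) s

/-- Cuculescu's projection `q(s) = ⋀ n, q n`, the projection onto the intersection of the ranges
of Cuculescu's projections for the martingale `f n` of conditional expectations of `f`. -/
def TracialState.cuculescu {N : VonNeumannAlgebra H} (τ : TracialState N)
    (F : ℕ → VonNeumannAlgebra H) (f : H →ₗ.[ℂ] H) (s : ℝ) : H →L[ℂ] H :=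
  proj (⨅ n, LinearMap.range (cuculescuSeq (fun n => τ.condExp (F n) f) s n).toLinearMap)

end NCMart

end

/-!
Positive self-adjoint operators are handled through their resolvents `R = (1 + T)⁻¹`, which are
positive contractions, and truncations and spectral projections become continuous functions and
kernels of bounded operators. In a finite von Neumann algebra a subspace invariant under the
commutant whose projection has full trace is dense; since two projections of traces `1 - δ` and
`1 - ε` meet in one of trace at least `1 - δ - ε`, the product `q f q` is densely defined and
essentially self-adjoint.

The conditional expectation onto `M` is obtained from a Radon–Nikodym argument: with
`φ = τ(f ·)` and `ψ = τ + φ` on `M`, the functional `z ↦ ψ(z²) - 2 τ(z)` has a minimizer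
`R ∈ M` with `0 ≤ R ≤ 1`, whose square, and hence itself, lies in the centralizer of `ψ`. Then
`ψ(R z) = τ(z)`, that is `φ(R z) = τ((1 - R) z)`, and the expectation is `R⁻¹ - 1`.

For the inequality, the increments `r n = q n - q (n + 1)` are projections of `F (n + 1)` on which
`q n f_{n+1} q n` is larger than `s`, so `s τ(r n) ≤ τ(f_{n+1} r n) = τ(f r n)`. Summing,
`s τ(1 - q n) ≤ τ(f (1 - q n))`, and splitting `f` at height `s / 2` bounds the right-hand side by
`s / 2 * τ(1 - q n) + τ(f 1_{(s/2,∞)}(f))`. The first term is absorbed, and `n → ∞` by normality.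
-/

noncomputable section

namespace NCMart

open Filter Topology

variable {H : Type*} [NormedAddCommGroup H] [InnerProductSpace ℂ H] [CompleteSpace H]

section VonNeumann

variable {M N : VonNeumannAlgebra H} {a u : H →L[ℂ] H}

theorem commute_of_mem_commutant (ha : a ∈ M) (hu : u ∈ M.commutant) : Commute u a :=
  (VonNeumannAlgebra.mem_commutant_iff.mp hu a ha).symm

theorem mem_of_forall_commute (h : ∀ u ∈ M.commutant, Commute u a) : a ∈ M := by
  rw [← M.commutant_commutant, VonNeumannAlgebra.mem_commutant_iff]
  exact h

theorem mem_commutant_of_le (h : M ≤ N) (hu : u ∈ N.commutant) : u ∈ M.commutant :=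
  VonNeumannAlgebra.mem_commutant_iff.mpr fun a ha =>
    VonNeumannAlgebra.mem_commutant_iff.mp hu a (h ha)

theorem isClosed_setOf_mem (M : VonNeumannAlgebra H) : IsClosed {a : H →L[ℂ] H | a ∈ M} := by
  have h := Set.isClosed_centralizer (Set.centralizer (M : Set (H →L[ℂ] H)))
  rwa [M.centralizer_centralizer] at h

theorem real_smul_mem (ha : a ∈ M) (r : ℝ) : r • a ∈ M :=
  mem_of_forall_commute fun _ hu => (commute_of_mem_commutant ha hu).smul_right r

theorem cfc_mem (ha : a ∈ M) (φ : ℝ → ℝ) : cfc φ a ∈ M :=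
  mem_of_forall_commute fun _ hu => ((commute_of_mem_commutant ha hu).symm.cfc_real φ).symm

theorem exists_mem_nonneg_mul_self_eq (ha : a ∈ M) (h : 0 ≤ a) : ∃ b ∈ M, 0 ≤ b ∧ b * b = a := by
  refine ⟨cfc Real.sqrt a, cfc_mem ha _, cfc_nonneg fun x _ => Real.sqrt_nonneg x, ?_⟩
  rw [← cfc_mul Real.sqrt Real.sqrt a]
  conv_rhs => rw [← cfc_id ℝ a]
  exact cfc_congr fun x hx => Real.mul_self_sqrt (spectrum_nonneg_of_nonneg h hx)

end VonNeumann

section Projections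

variable {K L : Submodule ℂ H} {a b p u : H →L[ℂ] H}

theorem isStarProjection_proj (K : Submodule ℂ H) : IsStarProjection (proj K) :=
  isStarProjection_starProjection

theorem proj_apply_of_mem {x : H} (hx : x ∈ K) : proj K x = x :=
  Submodule.starProjection_eq_self_iff.mpr (K.le_topologicalClosure hx)

theorem proj_apply_mem_closure (K : Submodule ℂ H) (x : H) : proj K x ∈ closure (K : Set H) := by
  rw [← Submodule.topologicalClosure_coe]
  exact Submodule.starProjection_apply_mem _ x

theorem proj_mono (h : K ≤ L) : proj K ≤ proj L :=
  Submodule.starProjection_le_starProjection_iff.mpr (Submodule.topologicalClosure_mono h)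

theorem mul_proj_congr (h : ∀ x ∈ K, a x = b x) : a * proj K = b * proj K :=
  ContinuousLinearMap.ext fun x => closure_minimal (fun y hy => h y hy)
    (isClosed_eq a.continuous b.continuous) (proj_apply_mem_closure K x)

theorem mul_proj_eq_proj (h : ∀ x ∈ K, a x = x) : a * proj K = proj K := by
  simpa only [one_mul] using mul_proj_congr (b := 1) h

theorem mul_proj_ker (a : H →L[ℂ] H) : a * proj a.toLinearMap.ker = 0 := by
  simpa only [zero_mul] using mul_proj_congr (a := a) (b := 0) (K := a.toLinearMap.ker)
    fun _ hx => hx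

theorem proj_range_mul (a : H →L[ℂ] H) : proj a.toLinearMap.range * a = a :=
  ContinuousLinearMap.ext fun x => proj_apply_of_mem ⟨x, rfl⟩

theorem proj_range_of_isStarProjection (hp : IsStarProjection p) :
    proj p.toLinearMap.range = p := by
  have h : p * proj p.toLinearMap.range = proj p.toLinearMap.range := by
    refine mul_proj_eq_proj ?_
    rintro _ ⟨y, rfl⟩
    exact DFunLike.congr_fun hp.isIdempotentElem.eq y
  have h' := congrArg star h
  rw [star_mul, (isStarProjection_proj _).isSelfAdjoint.star_eq, hp.isSelfAdjoint.star_eq,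
    proj_range_mul] at h'
  exact h'.symm

theorem commute_proj (h : ∀ x ∈ K, u x ∈ K) (h' : ∀ x ∈ K, star u x ∈ K) : Commute u (proj K) := by
  have invariant : ∀ v : H →L[ℂ] H, (∀ x ∈ K, v x ∈ K) → proj K * v * proj K = v * proj K :=
    fun v hv => mul_proj_congr fun x hx => proj_apply_of_mem (hv x hx)
  have h_star := congrArg star (invariant (star u) h')
  simp only [star_mul, star_star, (isStarProjection_proj K).isSelfAdjoint.star_eq,
    ← mul_assoc] at h_star
  exact (invariant u h).symm.trans h_star

theorem one_sub_proj_ker (a : H →L[ℂ] H) :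
    1 - proj a.toLinearMap.ker = proj (star a).toLinearMap.range := by
  have h_closed : a.toLinearMap.ker.topologicalClosure = a.toLinearMap.ker :=
    (ContinuousLinearMap.isClosed_ker a).submodule_topologicalClosure_eq
  have h_orth : (star a).toLinearMap.range.topologicalClosure = (a.toLinearMap.ker)ᗮ :=
    (ContinuousLinearMap.orthogonal_ker a).symm
  unfold proj
  simp only [h_closed, h_orth]
  exact (Submodule.starProjection_orthogonal' _).symm

theorem ker_mul_star (a : H →L[ℂ] H) : (a * star a).toLinearMap.ker = (star a).toLinearMap.ker :=
  ContinuousLinearMap.ker_self_comp_adjoint a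

theorem proj_range_mul_star (a : H →L[ℂ] H) :
    proj (a * star a).toLinearMap.range = proj a.toLinearMap.range := by
  have h := one_sub_proj_ker (a * star a)
  have h' := one_sub_proj_ker (star a)
  rw [star_mul, star_star] at h
  rw [star_star] at h'
  rw [← h, ← h', ker_mul_star]

theorem denseRange_of_isSelfAdjoint (ha : IsSelfAdjoint a) (hinj : Function.Injective a) :
    DenseRange a := by
  have h := ContinuousLinearMap.orthogonal_ker a
  rw [LinearMap.ker_eq_bot.2 hinj, Submodule.bot_orthogonal_eq_top,
    ← ContinuousLinearMap.star_eq_adjoint, ha.star_eq] at h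
  exact Submodule.dense_iff_topologicalClosure_eq_top.2 h.symm

variable {M : VonNeumannAlgebra H}

theorem proj_mem (h : ∀ u ∈ M.commutant, ∀ x ∈ K, u x ∈ K) : proj K ∈ M :=
  mem_of_forall_commute fun u hu => commute_proj (h u hu) (h (star u) (star_mem hu))

theorem proj_range_mem (ha : a ∈ M) : proj a.toLinearMap.range ∈ M := by
  refine proj_mem fun u hu => ?_
  rintro _ ⟨z, rfl⟩
  exact ⟨u z, (DFunLike.congr_fun (commute_of_mem_commutant ha hu).eq z).symm⟩

theorem proj_ker_mem (ha : a ∈ M) : proj a.toLinearMap.ker ∈ M := by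
  have h := sub_mem (one_mem M) (proj_range_mem (star_mem ha))
  rwa [← one_sub_proj_ker, sub_sub_cancel] at h

end Projections

/-- `φ` is the real part of a positive functional on `M` that is continuous along bounded strongly
convergent sequences; its values outside `M` are irrelevant. -/
structure IsNormalPositive (M : VonNeumannAlgebra H) (φ : (H →L[ℂ] H) → ℝ) : Prop where
  map_add : ∀ {a b}, a ∈ M → b ∈ M → φ (a + b) = φ a + φ b
  map_smul : ∀ {a}, a ∈ M → ∀ r : ℝ, φ (r • a) = r * φ a
  map_star : ∀ {a}, a ∈ M → φ (star a) = φ a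
  nonneg : ∀ {a}, a ∈ M → 0 ≤ a → 0 ≤ φ a
  tendsto : ∀ {a : ℕ → H →L[ℂ] H} {b : H →L[ℂ] H} {C : ℝ}, (∀ n, a n ∈ M) → b ∈ M →
    (∀ n, ‖a n‖ ≤ C) → (∀ x, Tendsto (fun n => a n x) atTop (𝓝 (b x))) →
    Tendsto (fun n => φ (a n)) atTop (𝓝 (φ b))

namespace IsNormalPositive

variable {M : VonNeumannAlgebra H} {φ χ : (H →L[ℂ] H) → ℝ} {a b : H →L[ℂ] H}

theorem add (hφ : IsNormalPositive M φ) (hχ : IsNormalPositive M χ) :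
    IsNormalPositive M fun a => φ a + χ a where
  map_add ha hb := by rw [hφ.map_add ha hb, hχ.map_add ha hb, add_add_add_comm]
  map_smul ha r := by rw [hφ.map_smul ha, hχ.map_smul ha, mul_add]
  map_star ha := by rw [hφ.map_star ha, hχ.map_star ha]
  nonneg ha h := add_nonneg (hφ.nonneg ha h) (hχ.nonneg ha h)
  tendsto ha hb hC h := (hφ.tendsto ha hb hC h).add (hχ.tendsto ha hb hC h)

variable (hφ : IsNormalPositive M φ)
include hφ

theorem map_neg (ha : a ∈ M) : φ (-a) = -φ a := by
  rw [← neg_one_smul ℝ a, hφ.map_smul ha, neg_one_mul]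

theorem map_sub (ha : a ∈ M) (hb : b ∈ M) : φ (a - b) = φ a - φ b := by
  rw [sub_eq_add_neg, hφ.map_add ha (neg_mem hb), hφ.map_neg hb, sub_eq_add_neg]

theorem map_zero : φ 0 = 0 := by
  simpa only [sub_self] using hφ.map_sub (zero_mem M) (zero_mem M)

theorem mono (ha : a ∈ M) (hb : b ∈ M) (h : a ≤ b) : φ a ≤ φ b := by
  have h_sub := hφ.nonneg (sub_mem hb ha) (sub_nonneg.mpr h)
  rwa [hφ.map_sub hb ha, sub_nonneg] at h_sub

theorem abs_le_of_isSelfAdjoint (ha : a ∈ M) (hsa : IsSelfAdjoint a) : |φ a| ≤ φ 1 * ‖a‖ := by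
  have h_upper := hφ.mono ha (real_smul_mem (one_mem M) ‖a‖)
    (by rw [← Algebra.algebraMap_eq_smul_one]; exact hsa.le_algebraMap_norm_self)
  have h_lower := hφ.mono (real_smul_mem (one_mem M) (-‖a‖)) ha
    (by rw [neg_smul, ← Algebra.algebraMap_eq_smul_one]; exact hsa.neg_algebraMap_norm_le_self)
  rw [hφ.map_smul (one_mem M)] at h_upper h_lower
  rw [_root_.abs_le]
  constructor <;> linarith

theorem abs_le (ha : a ∈ M) : |φ a| ≤ φ 1 * ‖a‖ := by
  set s : H →L[ℂ] H := (1 / 2 : ℝ) • (a + star a)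
  have hs : s ∈ M := real_smul_mem (add_mem ha (star_mem ha)) _
  have hsa : IsSelfAdjoint s := (IsSelfAdjoint.all (1 / 2 : ℝ)).smul (IsSelfAdjoint.add_star_self a)
  have h_eq : φ a = φ s := by
    rw [hφ.map_smul (add_mem ha (star_mem ha)), hφ.map_add ha (star_mem ha), hφ.map_star ha]
    ring
  have h_norm : ‖s‖ ≤ ‖a‖ := by
    have h := norm_add_le a (star a)
    rw [norm_star] at h
    rw [norm_smul, Real.norm_of_nonneg (by norm_num)]
    linarith
  rw [h_eq]
  exact (hφ.abs_le_of_isSelfAdjoint hs hsa).trans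
    (mul_le_mul_of_nonneg_left h_norm (hφ.nonneg (one_mem M) zero_le_one))

end IsNormalPositive

theorem tendsto_nhds_ultraweakTopology {ι : Type*} {l : Filter ι} {a : ι → H →L[ℂ] H}
    {b : H →L[ℂ] H} {C : ℝ} (hC : ∀ i, ‖a i‖ ≤ C)
    (h : ∀ x y, Tendsto (fun i => inner ℂ x (a i y)) l (𝓝 (inner ℂ x (b y)))) :
    Tendsto a l (@nhds _ (ultraweakTopology H) b) := by
  simp only [nhds_iInf, nhds_induced, tendsto_iInf, tendsto_comap_iff]
  intro ξ η
  have summable_sq : ∀ ζ : lp (fun _ : ℕ => H) 2, Summable fun i => ‖ζ i‖ ^ (2 : ℝ) := fun ζ => by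
    simpa using (lp.memℓp ζ).summable (by simp)
  refine tendsto_tsum_of_dominated_convergence (bound := fun i => C * (‖ξ i‖ * ‖η i‖)) ?_
    (fun i => h (ξ i) (η i)) (Eventually.of_forall fun i k => ?_)
  · exact (Real.summable_mul_of_Lp_Lq_of_nonneg Real.HolderConjugate.two_two
      (fun i => norm_nonneg _) (fun i => norm_nonneg _) (summable_sq ξ) (summable_sq η)).mul_left C
  · calc ‖inner ℂ (ξ k) (a i (η k))‖ ≤ ‖ξ k‖ * ‖a i (η k)‖ := norm_inner_le_norm _ _
      _ ≤ ‖ξ k‖ * (C * ‖η k‖) := by gcongr; exact (a i).le_of_opNorm_le (hC i) _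
      _ = C * (‖ξ k‖ * ‖η k‖) := mul_left_comm _ _ _

namespace TracialState

variable {M N : VonNeumannAlgebra H} (τ : TracialState N) {a b c : H →L[ℂ] H}

theorem re_of_mem (ha : a ∈ N) : τ.re a = (τ.toLinearMap ⟨a, ha⟩).re := dif_pos ha

theorem re_one : τ.re 1 = 1 := by
  rw [τ.re_of_mem (one_mem N)]
  exact congrArg Complex.re τ.map_one'

theorem re_add (ha : a ∈ N) (hb : b ∈ N) : τ.re (a + b) = τ.re a + τ.re b := by
  rw [τ.re_of_mem ha, τ.re_of_mem hb, τ.re_of_mem (add_mem ha hb), ← Complex.add_re, ← map_add]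
  rfl

theorem re_smul (ha : a ∈ N) (r : ℝ) : τ.re (r • a) = r * τ.re a := by
  have h : (⟨r • a, real_smul_mem ha r⟩ : N.toStarSubalgebra) = (r : ℂ) • ⟨a, ha⟩ :=
    Subtype.ext (Complex.coe_smul r a).symm
  rw [τ.re_of_mem ha, τ.re_of_mem (real_smul_mem ha r), h, map_smul, smul_eq_mul,
    Complex.re_ofReal_mul]

theorem re_mul_comm (ha : a ∈ N) (hb : b ∈ N) : τ.re (a * b) = τ.re (b * a) := by
  rw [τ.re_of_mem (mul_mem ha hb), τ.re_of_mem (mul_mem hb ha)]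
  exact congrArg Complex.re (τ.tracial' ⟨a, ha⟩ ⟨b, hb⟩)

theorem toLinearMap_nonneg (ha : a ∈ N) (h : 0 ≤ a) : 0 ≤ τ.toLinearMap ⟨a, ha⟩ := by
  obtain ⟨b, hb, hb0, rfl⟩ := exists_mem_nonneg_mul_self_eq ha h
  have h_star : star (⟨b, hb⟩ : N.toStarSubalgebra) = ⟨b, hb⟩ :=
    Subtype.ext (IsSelfAdjoint.of_nonneg hb0).star_eq
  have h_sq := τ.nonneg' ⟨b, hb⟩
  rwa [h_star] at h_sq

theorem re_nonneg (ha : a ∈ N) (h : 0 ≤ a) : 0 ≤ τ.re a := by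
  rw [τ.re_of_mem ha]
  exact (Complex.le_def.mp (τ.toLinearMap_nonneg ha h)).1

theorem eq_zero_of_re_eq_zero (ha : a ∈ N) (h : 0 ≤ a) (h0 : τ.re a = 0) : a = 0 := by
  have h_zero : τ.toLinearMap ⟨a, ha⟩ = 0 :=
    Complex.ext (by rw [← τ.re_of_mem ha, h0, Complex.zero_re])
      (Complex.le_def.mp (τ.toLinearMap_nonneg ha h)).2.symm
  obtain ⟨b, hb, hb0, rfl⟩ := exists_mem_nonneg_mul_self_eq ha h
  have h_star : star (⟨b, hb⟩ : N.toStarSubalgebra) = ⟨b, hb⟩ :=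
    Subtype.ext (IsSelfAdjoint.of_nonneg hb0).star_eq
  have hb_zero : (⟨b, hb⟩ : N.toStarSubalgebra) = 0 :=
    τ.faithful' _ (by rw [h_star]; exact h_zero)
  rw [show b = 0 from congrArg Subtype.val hb_zero, mul_zero]

-- Polarization: `τ((1 + i a)* (1 + i a))` is real, and so is `τ(a* a)`.
theorem re_star (ha : a ∈ N) : τ.re (star a) = τ.re a := by
  let A : N.toStarSubalgebra := ⟨a, ha⟩
  have h_expand : star (1 + Complex.I • A) * (1 + Complex.I • A)
      = 1 + Complex.I • A - Complex.I • star A + star A * A := by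
    rw [star_add, star_one, star_smul, RCLike.star_def, Complex.conj_I]
    simp only [add_mul, mul_add, one_mul, mul_one, smul_mul_assoc, mul_smul_comm, smul_smul,
      neg_smul, neg_mul, smul_add, smul_neg, Complex.I_mul_I, neg_neg, one_smul]
    abel
  have h_sum := (Complex.le_def.mp (τ.nonneg' (1 + Complex.I • A))).2
  have h_sq := (Complex.le_def.mp (τ.nonneg' A)).2
  rw [h_expand, map_add, map_sub, map_add, map_smul, map_smul, τ.map_one'] at h_sum
  simp only [Complex.zero_im, Complex.add_im, Complex.sub_im, Complex.one_im, smul_eq_mul,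
    Complex.I_mul_im] at h_sum h_sq
  have h_re : (τ.toLinearMap (star A)).re = (τ.toLinearMap A).re := by linarith
  rw [τ.re_of_mem ha, τ.re_of_mem (star_mem ha)]
  exact h_re

theorem tendsto_re_of_tendsto_inner {ι : Type*} {l : Filter ι} {a : ι → H →L[ℂ] H} {C : ℝ}
    (ha : ∀ i, a i ∈ N) (hb : b ∈ N) (hC : ∀ i, ‖a i‖ ≤ C)
    (h : ∀ x y, Tendsto (fun i => inner ℂ x (a i y)) l (𝓝 (inner ℂ x (b y)))) :
    Tendsto (fun i => τ.re (a i)) l (𝓝 (τ.re b)) := by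
  let : TopologicalSpace N.toStarSubalgebra :=
    TopologicalSpace.induced Subtype.val (ultraweakTopology H)
  have h_cont : Continuous τ.toLinearMap := τ.normal'
  have h_lim : Tendsto (fun i => (⟨a i, ha i⟩ : N.toStarSubalgebra)) l (𝓝 ⟨b, hb⟩) := by
    let := ultraweakTopology H
    rw [nhds_induced, tendsto_comap_iff]
    exact tendsto_nhds_ultraweakTopology hC h
  rw [τ.re_of_mem hb]
  exact ((Complex.continuous_re.tendsto _).comp ((h_cont.tendsto _).comp h_lim)).congr
    fun i => (τ.re_of_mem (ha i)).symm

theorem isNormalPositive (hM : M ≤ N) : IsNormalPositive M τ.re where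
  map_add ha hb := τ.re_add (hM ha) (hM hb)
  map_smul ha := τ.re_smul (hM ha)
  map_star ha := τ.re_star (hM ha)
  nonneg ha := τ.re_nonneg (hM ha)
  tendsto ha hb hC h := τ.tendsto_re_of_tendsto_inner (fun n => hM (ha n)) (hM hb) hC
    fun _ y => tendsto_const_nhds.inner (h y)

theorem tendsto_re {a : ℕ → H →L[ℂ] H} {C : ℝ} (ha : ∀ n, a n ∈ N) (hb : b ∈ N)
    (hC : ∀ n, ‖a n‖ ≤ C) (h : ∀ x, Tendsto (fun n => a n x) atTop (𝓝 (b x))) :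
    Tendsto (fun n => τ.re (a n)) atTop (𝓝 (τ.re b)) :=
  (τ.isNormalPositive le_rfl).tendsto ha hb hC h

theorem re_sub (ha : a ∈ N) (hb : b ∈ N) : τ.re (a - b) = τ.re a - τ.re b :=
  (τ.isNormalPositive le_rfl).map_sub ha hb

theorem re_mono (ha : a ∈ N) (hb : b ∈ N) (h : a ≤ b) : τ.re a ≤ τ.re b :=
  (τ.isNormalPositive le_rfl).mono ha hb h

theorem re_mul_nonneg (ha : a ∈ N) (hb : b ∈ N) (h : 0 ≤ a) (h' : 0 ≤ b) : 0 ≤ τ.re (a * b) := by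
  obtain ⟨c, hc, hc0, rfl⟩ := exists_mem_nonneg_mul_self_eq hb h'
  rw [← mul_assoc, τ.re_mul_comm (mul_mem ha hc) hc, ← mul_assoc]
  exact τ.re_nonneg (mul_mem (mul_mem hc ha) hc) (conjugate_nonneg_of_nonneg h hc0)

theorem re_mul_mono_left (ha : a ∈ N) (hb : b ∈ N) (hc : c ∈ N) (h : a ≤ b) (h' : 0 ≤ c) :
    τ.re (a * c) ≤ τ.re (b * c) := by
  have h_sub := τ.re_mul_nonneg (sub_mem hb ha) hc (sub_nonneg.mpr h) h'
  rwa [sub_mul, τ.re_sub (mul_mem hb hc) (mul_mem ha hc), sub_nonneg] at h_sub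

theorem re_mul_mono_right (ha : a ∈ N) (hb : b ∈ N) (hc : c ∈ N) (h : a ≤ b) (h' : 0 ≤ c) :
    τ.re (c * a) ≤ τ.re (c * b) := by
  rw [τ.re_mul_comm hc ha, τ.re_mul_comm hc hb]
  exact τ.re_mul_mono_left ha hb hc h h'

theorem isNormalPositive_re_mul (ha : a ∈ N) (h0 : 0 ≤ a) :
    IsNormalPositive N fun y => τ.re (a * y) where
  map_add hb hc := by rw [mul_add, τ.re_add (mul_mem ha hb) (mul_mem ha hc)]
  map_smul hb r := by rw [mul_smul_comm, τ.re_smul (mul_mem ha hb)]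
  map_star hb := by
    rw [← τ.re_star (mul_mem ha (star_mem hb)), star_mul, star_star,
      (IsSelfAdjoint.of_nonneg h0).star_eq, τ.re_mul_comm hb ha]
  nonneg hb hb0 := τ.re_mul_nonneg ha hb h0 hb0
  tendsto hb hc hC h := τ.tendsto_re (fun n => mul_mem ha (hb n)) (mul_mem ha hc)
    (fun n => norm_mul_le_of_le le_rfl (hC n)) fun x => (a.continuous.tendsto _).comp (h x)

theorem eq_one_of_one_le_re (ha : a ∈ N) (h : IsStarProjection a) (h1 : 1 ≤ τ.re a) : a = 1 := by
  have ha' := sub_mem (one_mem N) ha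
  have h_re : τ.re (1 - a) ≤ 0 := by
    rw [τ.re_sub (one_mem N) ha, τ.re_one]
    exact sub_nonpos.mpr h1
  have h_zero := τ.eq_zero_of_re_eq_zero ha' h.one_sub.nonneg
    (h_re.antisymm (τ.re_nonneg ha' h.one_sub.nonneg))
  exact (sub_eq_zero.mp h_zero).symm

end TracialState

omit [CompleteSpace H] in
theorem tendsto_apply_of_mem_closure {ι : Type*} {l : Filter ι} {a : ι → H →L[ℂ] H}
    {b : H →L[ℂ] H} {C : ℝ} (hC : ∀ i, ‖a i‖ ≤ C) {K : Set H}
    (h : ∀ y ∈ K, Tendsto (fun i => a i y) l (𝓝 (b y))) {x : H} (hx : x ∈ closure K) :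
    Tendsto (fun i => a i x) l (𝓝 (b x)) := by
  have h_lipschitz : ∀ i, LipschitzWith C.toNNReal (a i) := fun i =>
    (a i).lipschitz.weaken (NNReal.le_toNNReal_of_coe_le (hC i))
  exact closure_minimal h ((LipschitzWith.uniformEquicontinuous _ _
    h_lipschitz).equicontinuous.isClosed_setOfPred_tendsto b.continuous) hx

section RegularizedInverse

variable {a b : H →L[ℂ] H} {ε : ℝ}

/-- The operator `(b + ε)⁻¹`, a bounded substitute for the inverse of `b ≥ 0`. -/
def regInv (b : H →L[ℂ] H) (ε : ℝ) : H →L[ℂ] H := cfc (fun r : ℝ => (r + ε)⁻¹) b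

theorem commute_regInv (b : H →L[ℂ] H) (ε : ℝ) : Commute b (regInv b ε) :=
  ((Commute.refl b).cfc_real _).symm

theorem regInv_nonneg (hb : 0 ≤ b) (hε : 0 < ε) : 0 ≤ regInv b ε :=
  cfc_nonneg fun _ hr => inv_nonneg.mpr (add_nonneg (spectrum_nonneg_of_nonneg hb hr) hε.le)

theorem mul_regInv_add (hb : 0 ≤ b) (hε : 0 < ε) : b * regInv b ε + ε • regInv b ε = 1 := by
  have h_ne : ∀ r ∈ spectrum ℝ b, r + ε ≠ 0 := fun r hr =>
    (add_pos_of_nonneg_of_pos (spectrum_nonneg_of_nonneg hb hr) hε).ne'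
  have h_cont : ContinuousOn (fun r : ℝ => (r + ε)⁻¹) (spectrum ℝ b) :=
    ContinuousOn.inv₀ (by fun_prop) h_ne
  have h_add : cfc (fun r : ℝ => r + ε) b = b + ε • 1 := by
    rw [cfc_add_const ε (fun r : ℝ => r) b, cfc_id' ℝ b, Algebra.algebraMap_eq_smul_one]
  rw [← one_mul (regInv b ε), ← mul_assoc, mul_one, ← smul_mul_assoc, ← add_mul, ← h_add, regInv,
    ← cfc_mul (fun r : ℝ => r + ε) _ b (by fun_prop) h_cont, ← cfc_one ℝ b]
  exact cfc_congr fun r hr => mul_inv_cancel₀ (h_ne r hr)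

theorem mul_regInv_nonneg (hb : 0 ≤ b) (hε : 0 < ε) : 0 ≤ b * regInv b ε :=
  (commute_regInv b ε).mul_nonneg hb (regInv_nonneg hb hε)

theorem norm_mul_regInv_le_one (hb : 0 ≤ b) (hε : 0 < ε) : ‖b * regInv b ε‖ ≤ 1 := by
  rw [CStarAlgebra.norm_le_one_iff_of_nonneg _ (mul_regInv_nonneg hb hε), ← mul_regInv_add hb hε]
  exact le_add_of_nonneg_right (smul_nonneg hε.le (regInv_nonneg hb hε))

theorem tendsto_mul_regInv_apply (hb : 0 ≤ b) (x : H) :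
    Tendsto (fun n : ℕ => (b * regInv b (1 / ((n : ℝ) + 1))) x) atTop
      (𝓝 (proj b.toLinearMap.range x)) := by
  set P := proj b.toLinearMap.range
  have hε : ∀ n : ℕ, (0 : ℝ) < 1 / ((n : ℝ) + 1) := fun n => Nat.one_div_pos_of_nat
  have hP : ∀ ε, b * regInv b ε * P = b * regInv b ε := fun ε => by
    have h := congrArg star (proj_range_mul b)
    rw [star_mul, (IsSelfAdjoint.of_nonneg hb).star_eq,
      (isStarProjection_proj _).isSelfAdjoint.star_eq] at h
    rw [(commute_regInv b ε).eq, mul_assoc, h]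
  have h_range : ∀ y ∈ b.toLinearMap.range,
      Tendsto (fun n : ℕ => (b * regInv b (1 / ((n : ℝ) + 1))) y) atTop (𝓝 y) := by
    rintro _ ⟨z, rfl⟩
    have h_error : ∀ n : ℕ, ‖(b * regInv b (1 / ((n : ℝ) + 1))) (b z) - b z‖
        ≤ 1 / ((n : ℝ) + 1) * ‖z‖ := fun n => by
      set ε : ℝ := 1 / ((n : ℝ) + 1)
      have h : (1 - b * regInv b ε) * b = ε • (b * regInv b ε) := by
        rw [sub_eq_of_eq_add' (mul_regInv_add hb (hε n)).symm, smul_mul_assoc,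
          (commute_regInv b ε).eq]
      calc ‖(b * regInv b ε) (b z) - b z‖ = ‖((1 - b * regInv b ε) * b) z‖ := norm_sub_rev _ _
        _ = ε * ‖(b * regInv b ε) z‖ := by
          rw [h, _root_.smul_apply, norm_smul, Real.norm_of_nonneg (hε n).le]
        _ ≤ ε * (1 * ‖z‖) := by
          gcongr
          exact (b * regInv b ε).le_of_opNorm_le (norm_mul_regInv_le_one hb (hε n)) z
        _ = ε * ‖z‖ := by rw [one_mul]
    have h_lim := (tendsto_one_div_add_atTop_nhds_zero_nat (𝕜 := ℝ)).mul_const ‖z‖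
    rw [zero_mul] at h_lim
    exact tendsto_iff_norm_sub_tendsto_zero.mpr
      (squeeze_zero (fun _ => norm_nonneg _) h_error h_lim)
  have h_lim := tendsto_apply_of_mem_closure (b := 1)
    (fun n => norm_mul_regInv_le_one hb (hε n)) h_range (proj_apply_mem_closure _ x)
  exact h_lim.congr fun n => DFunLike.congr_fun (hP _) x

-- The positive operator `c = a* (a a* + ε)⁻¹ a` satisfies `c² ≤ c`.
theorem star_mul_regInv_mul_le_one (a : H →L[ℂ] H) (hε : 0 < ε) :
    star a * regInv (a * star a) ε * a ≤ 1 := by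
  have hb : 0 ≤ a * star a := mul_star_self_nonneg a
  set k := regInv (a * star a) ε
  have hk : 0 ≤ k := regInv_nonneg hb hε
  set c := star a * k * a
  have hc : 0 ≤ c := star_left_conjugate_nonneg hk a
  have h_sub : c - c * c = ε • (star a * (k * k) * a) := by
    have h : k * (1 - a * star a * k) = ε • (k * k) := by
      rw [sub_eq_of_eq_add' (mul_regInv_add hb hε).symm, mul_smul_comm]
    rw [← smul_mul_assoc, ← mul_smul_comm, ← h]
    simp only [c, mul_sub, sub_mul, mul_one, mul_assoc]
  have h_sq : c * c ≤ c := by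
    rw [← sub_nonneg, h_sub]
    exact smul_nonneg hε.le (star_left_conjugate_nonneg
      ((Commute.refl k).mul_nonneg hk hk) a)
  have h_norm : ‖c‖ * ‖c‖ ≤ ‖c‖ := by
    have h_star := CStarRing.norm_star_mul_self (x := c)
    rw [(IsSelfAdjoint.of_nonneg hc).star_eq] at h_star
    exact h_star ▸ CStarAlgebra.norm_le_norm_of_nonneg_of_le
      ((Commute.refl c).mul_nonneg hc hc) h_sq
  rw [← CStarAlgebra.norm_le_one_iff_of_nonneg c hc]
  by_contra! h
  nlinarith

end RegularizedInverse

theorem TracialState.re_proj_range_le {N : VonNeumannAlgebra H} (τ : TracialState N)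
    {a e : H →L[ℂ] H} (ha : a ∈ N) (he : e ∈ N) (hp : IsStarProjection e) (h : a * e = a) :
    τ.re (proj a.toLinearMap.range) ≤ τ.re e := by
  have hε : ∀ n : ℕ, (0 : ℝ) < 1 / ((n : ℝ) + 1) := fun n => Nat.one_div_pos_of_nat
  have hb : 0 ≤ a * star a := mul_star_self_nonneg a
  have hbN : a * star a ∈ N := mul_mem ha (star_mem ha)
  have hk : ∀ ε, regInv (a * star a) ε ∈ N := fun ε => cfc_mem hbN _
  have h_lim := τ.tendsto_re (fun n => mul_mem hbN (hk _)) (proj_range_mem hbN)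
    (fun n => norm_mul_regInv_le_one hb (hε n)) (tendsto_mul_regInv_apply hb)
  rw [proj_range_mul_star] at h_lim
  refine le_of_tendsto' h_lim fun n => ?_
  set k := regInv (a * star a) (1 / ((n : ℝ) + 1))
  have h_mem : star a * k * a ∈ N := mul_mem (mul_mem (star_mem ha) (hk _)) ha
  have h_corner : star a * k * a = star e * (star a * k * a) * e := by
    simp only [mul_assoc, h]
    rw [← mul_assoc (star e), ← star_mul, h]
  rw [mul_assoc, τ.re_mul_comm ha (mul_mem (star_mem ha) (hk _))]
  refine τ.re_mono h_mem he (h_corner.trans_le ?_)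
  rw [hp.isSelfAdjoint.star_eq]
  have h_le := star_left_conjugate_le_conjugate (star_mul_regInv_mul_le_one a (hε n)) e
  rwa [mul_one, hp.isSelfAdjoint.star_eq, hp.isIdempotentElem.eq] at h_le

/-- `u` maps the domain of `S` to itself and commutes with `S` on it. -/
def CommutesWith (u : H →L[ℂ] H) (S : H →ₗ.[ℂ] H) : Prop :=
  ∀ x : S.domain, ∃ hx : u x ∈ S.domain, S ⟨u x, hx⟩ = u (S x)

/-- A densely defined positive symmetric operator `S` for which `1 + S` has dense range: this is
how the essential self-adjointness of a positive operator is encoded here. -/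
structure IsEssentiallyPos (S : H →ₗ.[ℂ] H) : Prop where
  dense : Dense (S.domain : Set H)
  symm : ∀ x y : S.domain, inner ℂ (S x) (y : H) = inner ℂ (x : H) (S y)
  nonneg : ∀ x : S.domain, 0 ≤ (inner ℂ (S x) (x : H)).re
  dense_range : Dense (Set.range fun x : S.domain => (x : H) + S x)

/-- The bounded extension of `x + S x ↦ x`, which is `(1 + S.closure)⁻¹` when `S` is essentially
positive. -/
def coreResolvent (S : H →ₗ.[ℂ] H) : H →L[ℂ] H :=
  S.domain.subtype.extendOfNorm (S.domain.subtype + S.toFun)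

omit [CompleteSpace H] in
theorem nonneg_of_dense {A : H →L[ℂ] H} {s : Set H} (hs : Dense s)
    (h : ∀ y ∈ s, 0 ≤ inner ℂ (A y) y) : 0 ≤ A := by
  have hcl : IsClosed {y | 0 ≤ inner ℂ (A y) y} :=
    isClosed_le continuous_const (by fun_prop)
  have hall : ∀ y, 0 ≤ inner ℂ (A y) y := fun y => closure_minimal h hcl (hs y)
  rw [ContinuousLinearMap.nonneg_iff_isPositive, ContinuousLinearMap.isPositive_iff_complex]
  exact fun y => ⟨(Complex.eq_re_of_ofReal_le (hall y)).symm, (Complex.nonneg_iff.1 (hall y)).1⟩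

namespace IsEssentiallyPos

variable {S : H →ₗ.[ℂ] H} (hS : IsEssentiallyPos S)

include hS

theorem isClosable : S.IsClosable :=
  ((LinearPMap.adjoint_isClosed hS.dense).isClosable).leIsClosable
    (LinearPMap.IsFormalAdjoint.le_adjoint hS.dense fun x y => hS.symm x y)

omit [CompleteSpace H] in
theorem inner_nonneg (x : S.domain) : 0 ≤ inner ℂ (S x) (x : H) := by
  refine Complex.nonneg_iff.2 ⟨hS.nonneg x, (Complex.conj_eq_iff_im.1 ?_).symm⟩
  rw [inner_conj_symm, hS.symm]

omit [CompleteSpace H] in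
theorem norm_le_norm_add_apply (x : S.domain) : ‖(x : H)‖ ≤ ‖(x : H) + S x‖ := by
  have h : ‖S x + x‖ ^ 2 = _ := norm_add_sq (𝕜 := ℂ) (S x) (x : H)
  have h0 : 0 ≤ RCLike.re (inner ℂ (S x) (x : H)) := hS.nonneg x
  rw [add_comm (x : H)]
  exact le_of_sq_le_sq (by nlinarith [sq_nonneg ‖S x‖]) (norm_nonneg _)

theorem coreResolvent_apply (x : S.domain) : coreResolvent S ((x : H) + S x) = x :=
  LinearMap.extendOfNorm_eq (e := S.domain.subtype + S.toFun) hS.dense_range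
    ⟨1, fun x => (hS.norm_le_norm_add_apply x).trans_eq (one_mul _).symm⟩ x

theorem coreResolvent_nonneg : 0 ≤ coreResolvent S := by
  refine nonneg_of_dense hS.dense_range ?_
  rintro _ ⟨x, rfl⟩
  rw [hS.coreResolvent_apply, inner_add_right, ← hS.symm]
  exact add_nonneg (ContinuousLinearMap.isPositive_one.inner_nonneg_left _) (hS.inner_nonneg x)

theorem coreResolvent_le_one : coreResolvent S ≤ 1 := by
  rw [← sub_nonneg]
  refine nonneg_of_dense hS.dense_range ?_
  rintro _ ⟨x, rfl⟩
  rw [sub_apply, one_apply_eq_self, hS.coreResolvent_apply, add_sub_cancel_left, inner_add_right]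
  exact add_nonneg (hS.inner_nonneg x) (ContinuousLinearMap.isPositive_one.inner_nonneg_left _)

theorem isResolvent_closure : IsResolvent S.closure (coreResolvent S) := by
  set R := coreResolvent S
  have hgraph : S.closure.graph = S.graph.topologicalClosure :=
    hS.isClosable.graph_closure_eq_closure_graph.symm
  have hmem : ∀ y, (R y, y - R y) ∈ S.graph.topologicalClosure := by
    have hcl : IsClosed {y | (R y, y - R y) ∈ S.graph.topologicalClosure} :=
      S.graph.isClosed_topologicalClosure.preimage
        (by fun_prop : Continuous fun y => (R y, y - R y))
    refine fun y => closure_minimal ?_ hcl (hS.dense_range y)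
    rintro _ ⟨x, rfl⟩
    rw [Set.mem_ofPred_eq, hS.coreResolvent_apply, add_sub_cancel_left]
    exact S.graph.le_topologicalClosure (S.mem_graph x)
  have happly : ∀ p ∈ S.graph.topologicalClosure, R (p.1 + p.2) = p.1 := by
    have hcl : IsClosed {p : H × H | R (p.1 + p.2) = p.1} :=
      isClosed_eq (by fun_prop) (by fun_prop)
    refine fun p hp => closure_minimal (fun q hq => ?_) hcl hp
    obtain ⟨x, hx, hSx⟩ := (LinearPMap.mem_graph_iff S).1 hq
    rw [Set.mem_ofPred_eq, ← hx, ← hSx, hS.coreResolvent_apply]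
  refine ⟨fun y => ?_, fun x => happly (x, S.closure x) (hgraph.le (S.closure.mem_graph x))⟩
  obtain ⟨⟨z, hz⟩, rfl : z = R y, hSz⟩ := (LinearPMap.mem_graph_iff _).1 (hgraph.ge (hmem y))
  exact ⟨hz, by rw [hSz, add_sub_cancel]⟩

theorem commute_coreResolvent {u : H →L[ℂ] H} (hu : CommutesWith u S) :
    Commute u (coreResolvent S) := by
  refine ContinuousLinearMap.ext fun y => ?_
  refine congrFun (Continuous.ext_on hS.dense_range (f := fun y => u (coreResolvent S y))
    (g := fun y => coreResolvent S (u y)) (by fun_prop) (by fun_prop) ?_) y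
  rintro _ ⟨x, rfl⟩
  obtain ⟨hx, hSx⟩ := hu x
  beta_reduce
  rw [hS.coreResolvent_apply, map_add, ← hSx, hS.coreResolvent_apply ⟨u x, hx⟩]

end IsEssentiallyPos

section Resolvent

variable {T : H →ₗ.[ℂ] H} {R : H →L[ℂ] H}

omit [CompleteSpace H]

theorem IsResolvent.eq {R' : H →L[ℂ] H} (h : IsResolvent T R) (h' : IsResolvent T R') : R = R' := by
  ext y
  obtain ⟨hy, hTy⟩ := h.1 y
  have hR' := h'.2 ⟨R y, hy⟩
  rw [hTy] at hR'
  exact hR'.symm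

theorem IsResolvent.resolvent_eq (h : IsResolvent T R) : resolvent T = R := by
  have hex : ∃ R, IsResolvent T R := ⟨R, h⟩
  rw [resolvent, dif_pos hex]
  exact hex.choose_spec.eq h

theorem IsResolvent.injective (h : IsResolvent T R) : Function.Injective R := by
  refine (injective_iff_map_eq_zero R).2 fun y hy => ?_
  obtain ⟨hd, hTy⟩ := h.1 y
  have h0 : (⟨R y, hd⟩ : T.domain) = 0 := Subtype.ext hy
  rw [h0, LinearPMap.map_zero, hy, add_zero] at hTy
  exact hTy.symm

end Resolvent

theorem isEssentiallyPos_of_isSelfAdjoint {f : H →ₗ.[ℂ] H} (hf : IsSelfAdjoint f)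
    (hpos : ∀ x : f.domain, 0 ≤ (inner ℂ (f x) (x : H)).re) : IsEssentiallyPos f := by
  have hd : Dense (f.domain : Set H) := hf.dense_domain
  have hadj : f.adjoint = f := hf
  have hsymm : ∀ x y : f.domain, inner ℂ (f x) (y : H) = inner ℂ (x : H) (f y) := by
    have h := LinearPMap.adjoint_isFormalAdjoint hd
    rw [hadj] at h
    exact fun x y => h x y
  refine ⟨hd, hsymm, hpos, ?_⟩
  change Dense ((f.domain.subtype + f.toFun).range : Set H)
  rw [Submodule.dense_iff_topologicalClosure_eq_top,
    Submodule.topologicalClosure_eq_top_iff, Submodule.eq_bot_iff]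
  intro z hz
  have hweak : ∀ x : f.domain, inner ℂ (-z) (x : H) = inner ℂ z (f x) := fun x => by
    have h : inner ℂ ((x : H) + f x) z = 0 := hz _ ⟨x, rfl⟩
    rw [inner_eq_zero_symm, inner_add_right] at h
    rw [inner_neg_left]
    exact neg_eq_of_add_eq_zero_right h
  have hzd : z ∈ f.adjoint.domain := LinearPMap.mem_adjoint_domain_of_exists z ⟨-z, hweak⟩
  have hgraph : (z, -z) ∈ f.graph := by
    rw [← hadj, ← LinearPMap.adjoint_apply_eq hd ⟨z, hzd⟩ hweak]
    exact f.adjoint.mem_graph ⟨z, hzd⟩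
  obtain ⟨x, hx : (x : H) = z, hfx : f x = -z⟩ := (LinearPMap.mem_graph_iff f).1 hgraph
  have h := hpos x
  rw [hx, hfx, inner_neg_left, Complex.neg_re, neg_nonneg] at h
  exact (re_inner_self_nonpos (𝕜 := ℂ)).1 h

theorem closure_eq_of_isSelfAdjoint {f : H →ₗ.[ℂ] H} (hf : IsSelfAdjoint f) : f.closure = f := by
  have hc : f.IsClosed := hf.isClosed
  refine LinearPMap.eq_of_eq_graph ?_
  rw [← hc.isClosable.graph_closure_eq_closure_graph]
  exact hc.submodule_topologicalClosure_eq

omit [CompleteSpace H] in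
theorem re_inner_apply_mono {a b : H →L[ℂ] H} (h : a ≤ b) (x : H) :
    (inner ℂ (a x) x).re ≤ (inner ℂ (b x) x).re := by
  have hx := ((ContinuousLinearMap.le_def _ _).1 h).re_inner_nonneg_left x
  rwa [sub_apply, inner_sub_left, map_sub, sub_nonneg] at hx

theorem norm_sq_apply_le {b : H →L[ℂ] H} {c : ℝ} (h0 : 0 ≤ b) (hc : b ≤ c • 1) (y : H) :
    ‖b y‖ ^ 2 ≤ c * (inner ℂ (b y) y).re := by
  have hsa : IsSelfAdjoint b := .of_nonneg h0
  have hmul : b * b ≤ c • b := by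
    have h : 0 ≤ b * (c • 1 - b) := Commute.mul_nonneg h0 (sub_nonneg.2 hc)
      (((Commute.one_right b).smul_right c).sub_right (Commute.refl b))
    rwa [mul_sub, mul_smul_comm, mul_one, sub_nonneg] at h
  calc ‖b y‖ ^ 2 = (inner ℂ ((b * b) y) y).re := by
        rw [mul_apply_eq_comp, hsa.isSymmetric.apply_clm]
        exact (inner_self_eq_norm_sq (𝕜 := ℂ) (b y)).symm
    _ ≤ (inner ℂ ((c • b) y) y).re := re_inner_apply_mono hmul y
    _ = c * (inner ℂ (b y) y).re := by
        rw [_root_.smul_apply, inner_smul_left_eq_smul, Complex.smul_re, smul_eq_mul]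

theorem ker_le_ker_of_nonneg_of_le {a b : H →L[ℂ] H} (h0 : 0 ≤ a) (hab : a ≤ b) :
    b.toLinearMap.ker ≤ a.toLinearMap.ker := by
  intro x (hx : b x = 0)
  have ha : a ≤ ‖a‖ • 1 := by
    simpa only [Algebra.algebraMap_eq_smul_one] using
      (IsSelfAdjoint.of_nonneg h0).le_algebraMap_norm_self
  have hinner : (inner ℂ (a x) x).re ≤ 0 := by
    simpa only [hx, inner_zero_left, Complex.zero_re] using re_inner_apply_mono hab x
  have hnorm := norm_sq_apply_le h0 ha x
  exact norm_eq_zero.1 (pow_eq_zero_iff two_ne_zero |>.1 (le_antisymm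
    (hnorm.trans (mul_nonpos_of_nonneg_of_nonpos (norm_nonneg _) hinner)) (sq_nonneg _)))

/-- The spectral projection `1_{[c,1]}(R)`, with `c = (1 + t)⁻¹`: if `R` is the resolvent of `T`,
this is `1_{[0,t]}(T)`. -/
def specProj (R : H →L[ℂ] H) (t : ℝ) : H →L[ℂ] H :=
  proj (cfc (fun r : ℝ => max ((1 + t)⁻¹ - r) 0) R).toLinearMap.ker

/-- The operator `max(R, c)⁻¹`, with `c = (1 + t)⁻¹`: a bounded inverse of `R` on the range of
`specProj R t`. -/
def specInv (R : H →L[ℂ] H) (t : ℝ) : H →L[ℂ] H := cfc (fun r : ℝ => (max r (1 + t)⁻¹)⁻¹) R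

/-- The operator `T 1_{[0,t]}(T)` in terms of the resolvent `R` of `T`. -/
def truncOp (R : H →L[ℂ] H) (t : ℝ) : H →L[ℂ] H := (specInv R t - 1) * specProj R t

section Spectral

variable {M : VonNeumannAlgebra H} {R : H →L[ℂ] H} {s t : ℝ}

theorem isStarProjection_specProj : IsStarProjection (specProj R t) := isStarProjection_proj _

theorem specProj_mem (hR : R ∈ M) (t : ℝ) : specProj R t ∈ M := proj_ker_mem (cfc_mem hR _)

theorem specInv_mem (hR : R ∈ M) (t : ℝ) : specInv R t ∈ M := cfc_mem hR _

theorem truncOp_mem (hR : R ∈ M) (t : ℝ) : truncOp R t ∈ M :=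
  mul_mem (sub_mem (specInv_mem hR t) (one_mem M)) (specProj_mem hR t)

theorem commute_specProj {u : H →L[ℂ] H} (h : Commute u R) (h' : Commute (star u) R) (t : ℝ) :
    Commute u (specProj R t) := by
  have invariant : ∀ v : H →L[ℂ] H, Commute v R →
      ∀ x ∈ (cfc (fun r : ℝ => max ((1 + t)⁻¹ - r) 0) R).toLinearMap.ker,
        v x ∈ (cfc (fun r : ℝ => max ((1 + t)⁻¹ - r) 0) R).toLinearMap.ker := by
    intro v hv x (hx : cfc _ R x = 0)
    have hcomm := DFunLike.congr_fun (hv.symm.cfc_real fun r : ℝ => max ((1 + t)⁻¹ - r) 0).eq x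
    rw [mul_apply_eq_comp, mul_apply_eq_comp, hx, map_zero] at hcomm
    exact hcomm
  exact commute_proj (invariant u h) (invariant (star u) h')

theorem commute_specProj_self (hR : IsSelfAdjoint R) (t : ℝ) : Commute R (specProj R t) :=
  commute_specProj (Commute.refl R) (by rw [hR.star_eq]) t

theorem commute_specInv_self (R : H →L[ℂ] H) (t : ℝ) : Commute (specInv R t) R :=
  (Commute.refl R).cfc_real _

theorem commute_specInv_specProj (hR : IsSelfAdjoint R) (s t : ℝ) :
    Commute (specInv R s) (specProj R t) :=
  (commute_specProj_self hR t).cfc_real _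

theorem commute_specProj_specProj (hR : IsSelfAdjoint R) (s t : ℝ) :
    Commute (specProj R s) (specProj R t) := by
  refine commute_specProj (commute_specProj_self hR s).symm ?_ t
  rw [isStarProjection_specProj.isSelfAdjoint.star_eq]
  exact (commute_specProj_self hR s).symm

theorem commute_specInv_sub_one_specProj (hR : IsSelfAdjoint R) (s t : ℝ) :
    Commute (specInv R s - 1) (specProj R t) :=
  (commute_specInv_specProj hR s t).sub_left (Commute.one_left _)

theorem commute_truncOp_specProj (hR : IsSelfAdjoint R) (s t : ℝ) :
    Commute (truncOp R s) (specProj R t) :=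
  (commute_specInv_sub_one_specProj hR s t).mul_left (commute_specProj_specProj hR s t)

theorem continuous_inv_max (ht : 0 ≤ t) : Continuous fun r : ℝ => (max r (1 + t)⁻¹)⁻¹ :=
  Continuous.inv₀ (by fun_prop) fun _ =>
    (lt_max_of_lt_right (inv_pos.2 (by linarith : 0 < 1 + t))).ne'

theorem one_le_specInv (h0 : 0 ≤ R) (h1 : R ≤ 1) (ht : 0 ≤ t) : 1 ≤ specInv R t := by
  have hsa : IsSelfAdjoint R := .of_nonneg h0
  rw [specInv, one_le_cfc_iff _ R (continuous_inv_max ht).continuousOn]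
  intro r hr
  exact (one_le_inv₀ (lt_max_of_lt_right (by positivity))).2
    (max_le ((CFC.le_one_iff (R := ℝ) R).1 h1 r hr) (inv_le_one_of_one_le₀ (by linarith)))

theorem specInv_le (h0 : 0 ≤ R) (ht : 0 ≤ t) : specInv R t ≤ (1 + t) • 1 := by
  rw [← Algebra.algebraMap_eq_smul_one, specInv]
  exact cfc_le_algebraMap _ _ R
    (fun r _ => inv_le_of_inv_le₀ (by positivity) (le_max_right _ _))
    (continuous_inv_max ht).continuousOn (.of_nonneg h0)

theorem mul_specInv_mul_specProj (h0 : 0 ≤ R) (ht : 0 ≤ t) :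
    R * specInv R t * specProj R t = specProj R t := by
  have hsa : IsSelfAdjoint R := .of_nonneg h0
  have hsplit : ∀ r : ℝ, r * (max r (1 + t)⁻¹)⁻¹ + (1 + t) • max ((1 + t)⁻¹ - r) 0 = 1 := by
    intro r
    have ht1 : 0 < 1 + t := by positivity
    rcases le_total r (1 + t)⁻¹ with h | h
    · rw [max_eq_right h, max_eq_left (by linarith), smul_eq_mul]
      field_simp
      ring
    · rw [max_eq_left h, max_eq_right (by linarith), smul_zero, add_zero,
        mul_inv_cancel₀ ((inv_pos.2 ht1).trans_le h).ne']
  have hsum : R * specInv R t + (1 + t) • cfc (fun r : ℝ => max ((1 + t)⁻¹ - r) 0) R = 1 := by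
    have hmul : R * specInv R t = cfc (fun r : ℝ => r * (max r (1 + t)⁻¹)⁻¹) R := by
      rw [cfc_mul (fun r : ℝ => r) _ R continuousOn_id (continuous_inv_max ht).continuousOn,
        cfc_id' ℝ R, specInv]
    rw [hmul, ← cfc_smul (1 + t) (fun r : ℝ => max ((1 + t)⁻¹ - r) 0) R (by fun_prop),
      ← cfc_add R (fun r : ℝ => r * (max r (1 + t)⁻¹)⁻¹) _
        (continuous_id.mul (continuous_inv_max ht)).continuousOn (by fun_prop), ← cfc_one ℝ R]
    exact cfc_congr fun r _ => hsplit r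
  simpa only [add_mul, smul_mul_assoc, specProj, mul_proj_ker, smul_zero, add_zero, one_mul]
    using congrArg (· * specProj R t) hsum

theorem specProj_mul_cfc (R : H →L[ℂ] H) (t : ℝ) :
    specProj R t * cfc (fun r : ℝ => max (r - (1 + t)⁻¹) 0) R
      = cfc (fun r : ℝ => max (r - (1 + t)⁻¹) 0) R := by
  have hmul : cfc (fun r : ℝ => max ((1 + t)⁻¹ - r) 0) R *
      cfc (fun r : ℝ => max (r - (1 + t)⁻¹) 0) R = 0 := by
    rw [← cfc_mul _ _ R (by fun_prop) (by fun_prop), ← cfc_zero ℝ R]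
    refine cfc_congr fun r _ => ?_
    rcases le_total r (1 + t)⁻¹ with h | h <;> simp [max_eq_right (sub_nonpos.2 h)]
  exact ContinuousLinearMap.ext fun x => proj_apply_of_mem (DFunLike.congr_fun hmul x)

theorem exists_mul_one_sub_specProj_eq (h0 : 0 ≤ R) (ht : 0 ≤ t) :
    ∃ b : H →L[ℂ] H, 0 ≤ b ∧ b ≤ (1 + t)⁻¹ • 1 ∧
      R * (1 - specProj R t) = b * (1 - specProj R t) := by
  have hsa : IsSelfAdjoint R := .of_nonneg h0
  refine ⟨cfc (fun r : ℝ => min r (1 + t)⁻¹) R, ?_, ?_, ?_⟩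
  · exact cfc_nonneg fun r hr => le_min (spectrum_nonneg_of_nonneg h0 hr) (by positivity)
  · rw [← Algebra.algebraMap_eq_smul_one]
    exact cfc_le_algebraMap _ _ R fun r _ => min_le_right _ _
  have hsplit : R = cfc (fun r : ℝ => min r (1 + t)⁻¹) R
      + cfc (fun r : ℝ => max (r - (1 + t)⁻¹) 0) R := by
    rw [← cfc_add R _ _ (by fun_prop) (by fun_prop)]
    conv_lhs => rw [← cfc_id' ℝ R]
    refine cfc_congr fun r _ => ?_
    rcases le_total r (1 + t)⁻¹ with h | h <;> simp [h]
  have hzero : cfc (fun r : ℝ => max (r - (1 + t)⁻¹) 0) R * (1 - specProj R t) = 0 := by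
    have hcomm := (commute_specProj_self hsa t).cfc_real fun r : ℝ => max (r - (1 + t)⁻¹) 0
    rw [mul_sub, mul_one, hcomm.eq, specProj_mul_cfc, sub_self]
  calc R * (1 - specProj R t) = _ := congrArg (· * (1 - specProj R t)) hsplit
    _ = _ := by rw [add_mul, hzero, add_zero]

theorem norm_mul_one_sub_specProj_le (h0 : 0 ≤ R) (ht : 0 ≤ t) :
    ‖R * (1 - specProj R t)‖ ≤ (1 + t)⁻¹ := by
  obtain ⟨b, hb0, hb, heq⟩ := exists_mul_one_sub_specProj_eq h0 ht
  have hnorm : ‖b‖ ≤ (1 + t)⁻¹ := by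
    rw [← Algebra.algebraMap_eq_smul_one] at hb
    exact (CStarAlgebra.norm_le_iff_le_algebraMap b (by positivity) hb0).2 hb
  rw [heq]
  exact (norm_mul_le _ _).trans ((mul_le_mul hnorm
    (IsStarProjection.norm_le _ isStarProjection_specProj.one_sub) (norm_nonneg _)
    (by positivity)).trans_eq (mul_one _))

theorem norm_sq_apply_le_of_specProj_apply_eq_zero (h0 : 0 ≤ R) (ht : 0 ≤ t) {y : H}
    (hy : specProj R t y = 0) : ‖R y‖ ^ 2 ≤ (1 + t)⁻¹ * (inner ℂ (R y) y).re := by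
  obtain ⟨b, hb0, hb, heq⟩ := exists_mul_one_sub_specProj_eq h0 ht
  have hRy : R y = b y := by
    simpa only [mul_apply_eq_comp, sub_apply, one_apply_eq_self, hy, sub_zero]
      using DFunLike.congr_fun heq y
  rw [hRy]
  exact norm_sq_apply_le hb0 hb y

theorem tendsto_specProj (h0 : 0 ≤ R) (hinj : Function.Injective R) (x : H) :
    Tendsto (fun k : ℕ => specProj R k x) atTop (𝓝 x) := by
  have hsa : IsSelfAdjoint R := .of_nonneg h0
  refine tendsto_apply_of_mem_closure (b := 1)
    (fun k => IsStarProjection.norm_le _ isStarProjection_specProj) ?_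
    (denseRange_of_isSelfAdjoint hsa hinj x)
  rintro _ ⟨z, rfl⟩
  have hlim : Tendsto (fun k : ℕ => (1 + (k : ℝ))⁻¹ * ‖z‖) atTop (𝓝 0) := by
    simpa [add_comm] using (tendsto_one_div_add_atTop_nhds_zero_nat (𝕜 := ℝ)).mul_const ‖z‖
  refine tendsto_iff_norm_sub_tendsto_zero.2 (squeeze_zero_norm (fun k => ?_) hlim)
  have heq : R z - specProj R k (R z) = (R * (1 - specProj R k)) z := by
    rw [mul_sub, mul_one, (commute_specProj_self hsa k).eq]
    rfl
  rw [norm_norm, norm_sub_rev]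
  change ‖R z - specProj R k (R z)‖ ≤ _
  rw [heq]
  exact (ContinuousLinearMap.le_opNorm _ _).trans (mul_le_mul_of_nonneg_right
    (norm_mul_one_sub_specProj_le h0 k.cast_nonneg) (norm_nonneg _))

theorem specProj_mul_specProj_of_le (hs : 0 ≤ s) (hst : s ≤ t) :
    specProj R t * specProj R s = specProj R s := by
  refine mul_proj_eq_proj fun x hx => proj_apply_of_mem (ker_le_ker_of_nonneg_of_le ?_ ?_ hx)
  · exact cfc_nonneg fun r _ => le_max_right _ _
  · refine cfc_mono fun r _ => max_le_max_right 0 (sub_le_sub_right ?_ r)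
    exact inv_anti₀ (by positivity) (by linarith)

theorem truncOp_nonneg (h0 : 0 ≤ R) (h1 : R ≤ 1) (ht : 0 ≤ t) : 0 ≤ truncOp R t :=
  (commute_specInv_sub_one_specProj (.of_nonneg h0) t t).mul_nonneg
    (sub_nonneg.2 (one_le_specInv h0 h1 ht)) isStarProjection_specProj.nonneg

theorem truncOp_mul_specProj (R : H →L[ℂ] H) (t : ℝ) :
    truncOp R t * specProj R t = truncOp R t := by
  rw [truncOp, mul_assoc, isStarProjection_specProj.isIdempotentElem.eq]

theorem truncOp_le (h0 : 0 ≤ R) (ht : 0 ≤ t) : truncOp R t ≤ t • 1 := by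
  have hsub : 0 ≤ t • 1 - (specInv R t - 1) := by
    have h := sub_nonneg.2 (specInv_le h0 ht)
    rwa [add_smul, one_smul, add_comm, ← sub_sub_eq_add_sub] at h
  have h : 0 ≤ (t • 1 - (specInv R t - 1)) * specProj R t :=
    Commute.mul_nonneg hsub isStarProjection_specProj.nonneg
      (((Commute.one_left _).smul_left t).sub_left
        (commute_specInv_sub_one_specProj (.of_nonneg h0) t t))
  rw [sub_mul, smul_mul_assoc, one_mul, sub_nonneg] at h
  exact h.trans (smul_le_smul_of_nonneg_left isStarProjection_specProj.le_one ht)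

theorem truncOp_mul_specProj_of_le (h0 : 0 ≤ R) (hs : 0 ≤ s) (hst : s ≤ t) :
    truncOp R t * specProj R s = truncOp R s := by
  have hcomm : Commute (specInv R t * R) (specInv R s) :=
    (cfc_commute_cfc _ _ R).mul_left (commute_specInv_self R s).symm
  have hinv : specInv R t * specProj R s = specInv R s * specProj R s := by
    calc specInv R t * specProj R s
        = specInv R t * R * specInv R s * specProj R s := by
          rw [mul_assoc _ _ (specProj R s), mul_assoc, ← mul_assoc R,
            mul_specInv_mul_specProj h0 hs]
      _ = specInv R s * (R * specInv R t * specProj R t) * specProj R s := by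
          rw [hcomm.eq, (commute_specInv_self R t).eq]
          simp only [mul_assoc, specProj_mul_specProj_of_le hs hst]
      _ = specInv R s * specProj R s := by
          rw [mul_specInv_mul_specProj h0 (hs.trans hst), mul_assoc,
            specProj_mul_specProj_of_le hs hst]
  rw [truncOp, mul_assoc, specProj_mul_specProj_of_le hs hst, sub_mul, hinv, ← sub_mul, truncOp]

theorem truncOp_mono (h0 : 0 ≤ R) (h1 : R ≤ 1) (hs : 0 ≤ s) (hst : s ≤ t) :
    truncOp R s ≤ truncOp R t := by
  have h : 0 ≤ truncOp R t * (1 - specProj R s) :=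
    ((Commute.one_right _).sub_right (commute_truncOp_specProj (.of_nonneg h0) t s)).mul_nonneg
      (truncOp_nonneg h0 h1 (hs.trans hst)) isStarProjection_specProj.one_sub.nonneg
  rwa [mul_sub, mul_one, truncOp_mul_specProj_of_le h0 hs hst, sub_nonneg] at h

theorem truncOp_mul_specProj_le (h0 : 0 ≤ R) (hs : 0 ≤ s) (ht : 0 ≤ t) :
    truncOp R s * specProj R t ≤ t • 1 := by
  rcases le_total t s with hts | hst
  · rw [truncOp_mul_specProj_of_le h0 ht hts]
    exact truncOp_le h0 ht
  · rw [truncOp, mul_assoc, (commute_specProj_specProj (.of_nonneg h0) s t).eq,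
      specProj_mul_specProj_of_le hs hst]
    exact (truncOp_le h0 hs).trans (smul_le_smul_of_nonneg_right hst zero_le_one)

theorem TracialState.tendsto_re_one_sub_specProj {N : VonNeumannAlgebra H} (τ : TracialState N)
    (hR : R ∈ N) (h0 : 0 ≤ R) (hinj : Function.Injective R) :
    Tendsto (fun k : ℕ => τ.re (1 - specProj R k)) atTop (𝓝 0) := by
  have h := (τ.tendsto_re (fun k : ℕ => specProj_mem hR k) (one_mem N)
    (fun k => IsStarProjection.norm_le _ isStarProjection_specProj)
    (tendsto_specProj h0 hinj)).const_sub (τ.re 1)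
  rw [sub_self] at h
  exact h.congr fun k => (τ.re_sub (one_mem N) (specProj_mem hR k)).symm

end Spectral

/-- `R` is the resolvent of `T` and a positive contraction: this is how the positive self-adjoint
operators are handled, through bounded operators. -/
structure IsPosResolvent (T : H →ₗ.[ℂ] H) (R : H →L[ℂ] H) : Prop where
  isResolvent : IsResolvent T R
  nonneg : 0 ≤ R
  le_one : R ≤ 1

namespace IsPosResolvent

variable {T : H →ₗ.[ℂ] H} {R : H →L[ℂ] H} {t : ℝ} (hT : IsPosResolvent T R)

include hT

theorem isSelfAdjoint : IsSelfAdjoint R := .of_nonneg hT.nonneg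

theorem spectralLE_eq (t : ℝ) : spectralLE T t = specProj R t := by
  rw [spectralLE, hT.isResolvent.resolvent_eq, specProj]

theorem exists_apply_eq_truncOp (ht : 0 ≤ t) {x : H} (hx : specProj R t x = x) :
    ∃ h : x ∈ T.domain, T ⟨x, h⟩ = truncOp R t x := by
  have hinv : R (specInv R t x) = x := by
    simpa only [mul_apply_eq_comp, hx]
      using DFunLike.congr_fun (mul_specInv_mul_specProj hT.nonneg ht) x
  obtain ⟨hd, hsum⟩ := hT.isResolvent.1 (specInv R t x)
  simp only [hinv] at hd hsum
  refine ⟨hd, ?_⟩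
  rw [truncOp, mul_apply_eq_comp, hx, sub_apply, one_apply_eq_self, eq_sub_iff_add_eq', hsum]

theorem truncation_eq (ht : 0 ≤ t) : truncation T t = truncOp R t := by
  have happly : ∀ x, ∃ hx : spectralLE T t x ∈ T.domain,
      truncOp R t x = T ⟨spectralLE T t x, hx⟩ := by
    intro x
    rw [hT.spectralLE_eq]
    obtain ⟨hd, hTx⟩ := hT.exists_apply_eq_truncOp ht (x := specProj R t x)
      (DFunLike.congr_fun isStarProjection_specProj.isIdempotentElem.eq x)
    exact ⟨hd, by rw [hTx, ← mul_apply_eq_comp, truncOp_mul_specProj]⟩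
  have hex : ∃ a : H →L[ℂ] H, ∀ x, ∃ hx : spectralLE T t x ∈ T.domain,
    a x = T ⟨spectralLE T t x, hx⟩ := ⟨_, happly⟩
  rw [truncation, dif_pos hex]
  ext x
  rw [(hex.choose_spec x).2, (happly x).2]

theorem le_re_inner (ht : 0 ≤ t) (x : T.domain) (hx : specProj R t (x : H) = 0) :
    t * ‖(x : H)‖ ^ 2 ≤ (inner ℂ (T x) (x : H)).re := by
  have hRx : R (x + T x) = x := hT.isResolvent.2 x
  have hzero : specProj R t (x + T x) = 0 := by
    refine (map_eq_zero_iff R hT.isResolvent.injective).1 ?_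
    rw [← mul_apply_eq_comp, (commute_specProj_self hT.isSelfAdjoint t).eq, mul_apply_eq_comp,
      hRx, hx]
  have h := norm_sq_apply_le_of_specProj_apply_eq_zero hT.nonneg ht hzero
  have hxx : (inner ℂ (x : H) (x : H)).re = ‖(x : H)‖ ^ 2 := inner_self_eq_norm_sq (𝕜 := ℂ) _
  have hsymm : (inner ℂ (x : H) (T x)).re = (inner ℂ (T x) (x : H)).re := inner_re_symm (𝕜 := ℂ) _ _
  rw [hRx, inner_add_right, Complex.add_re, hxx, hsymm, inv_mul_eq_div,
    le_div_iff₀ (by positivity)] at h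
  linarith

end IsPosResolvent

theorem IsPosResolvent.traceMul_eq {N : VonNeumannAlgebra H} (τ : TracialState N)
    {g : H →ₗ.[ℂ] H} {R : H →L[ℂ] H} (hR : IsPosResolvent g R) (x : H →L[ℂ] H) :
    τ.traceMul g x = ⨆ k : ℕ, ENNReal.ofReal (τ.re (truncOp R k * x)) := by
  simp only [TracialState.traceMul, hR.truncation_eq (Nat.cast_nonneg _)]

namespace TracialState.MemL1Pos

variable {N M : VonNeumannAlgebra H} {τ : TracialState N} {g : H →ₗ.[ℂ] H}

theorem isEssentiallyPos (hg : τ.MemL1Pos M g) : IsEssentiallyPos g :=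
  isEssentiallyPos_of_isSelfAdjoint hg.isSelfAdjoint hg.nonneg

theorem exists_isPosResolvent (hg : τ.MemL1Pos M g) : ∃ R ∈ M, IsPosResolvent g R := by
  have h := hg.isEssentiallyPos
  have hR := h.isResolvent_closure
  rw [closure_eq_of_isSelfAdjoint hg.isSelfAdjoint] at hR
  exact ⟨coreResolvent g,
    mem_of_forall_commute fun u hu => h.commute_coreResolvent (hg.affiliated u hu),
    hR, h.coreResolvent_nonneg, h.coreResolvent_le_one⟩

end TracialState.MemL1Pos

namespace IsNormalPositive

variable {M : VonNeumannAlgebra H} {φ χ : (H →L[ℂ] H) → ℝ}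

theorem sub (hφ : IsNormalPositive M φ) (hχ : IsNormalPositive M χ)
    (h : ∀ a ∈ M, 0 ≤ a → χ a ≤ φ a) : IsNormalPositive M fun a => φ a - χ a where
  map_add ha hb := by rw [hφ.map_add ha hb, hχ.map_add ha hb, add_sub_add_comm]
  map_smul ha r := by rw [hφ.map_smul ha, hχ.map_smul ha, mul_sub]
  map_star ha := by rw [hφ.map_star ha, hχ.map_star ha]
  nonneg ha h0 := sub_nonneg.2 (h _ ha h0)
  tendsto ha hb hC hlim := (hφ.tendsto ha hb hC hlim).sub (hχ.tendsto ha hb hC hlim)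

theorem restrict {N : VonNeumannAlgebra H} (hφ : IsNormalPositive N φ) (hM : M ≤ N) :
    IsNormalPositive M φ where
  map_add ha hb := hφ.map_add (hM ha) (hM hb)
  map_smul ha := hφ.map_smul (hM ha)
  map_star ha := hφ.map_star (hM ha)
  nonneg ha := hφ.nonneg (hM ha)
  tendsto ha hb := hφ.tendsto (fun n => hM (ha n)) (hM hb)

section Monotone

variable {φ : ℕ → (H →L[ℂ] H) → ℝ} (hφ : ∀ k, IsNormalPositive M (φ k))
  (hmono : ∀ a ∈ M, 0 ≤ a → Monotone fun k => φ k a)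

include hφ hmono

theorem dist_le_of_monotone {a : H →L[ℂ] H} (ha : a ∈ M) {k l : ℕ} (hkl : k ≤ l) :
    dist (φ k a) (φ l a) ≤ (φ l 1 - φ k 1) * ‖a‖ := by
  rw [dist_comm, Real.dist_eq]
  exact ((hφ l).sub (hφ k) fun b hb hb0 => hmono b hb hb0 hkl).abs_le ha

theorem exists_tendsto_of_monotone (hbdd : BddAbove (Set.range fun k => φ k 1))
    {a : H →L[ℂ] H} (ha : a ∈ M) : ∃ t, Tendsto (fun k => φ k a) atTop (𝓝 t) := by
  have hmono1 := hmono 1 (one_mem M) zero_le_one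
  have hone := tendsto_atTop_ciSup hmono1 hbdd
  set T := ⨆ k, φ k 1
  refine cauchySeq_tendsto_of_complete (cauchySeq_of_le_tendsto_0' (fun k => (T - φ k 1) * ‖a‖)
    (fun k l hkl => (dist_le_of_monotone hφ hmono ha hkl).trans ?_) ?_)
  · gcongr
    exact hmono1.ge_of_tendsto hone l
  · simpa only [sub_self, zero_mul] using (hone.const_sub T).mul_const ‖a‖

theorem of_monotone {χ : (H →L[ℂ] H) → ℝ}
    (hlim : ∀ a ∈ M, Tendsto (fun k => φ k a) atTop (𝓝 (χ a))) : IsNormalPositive M χ where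
  map_add ha hb := tendsto_nhds_unique (hlim _ (add_mem ha hb))
    (((hlim _ ha).add (hlim _ hb)).congr fun k => ((hφ k).map_add ha hb).symm)
  map_smul ha r := tendsto_nhds_unique (hlim _ (real_smul_mem ha r))
    (((hlim _ ha).const_mul r).congr fun k => ((hφ k).map_smul ha r).symm)
  map_star ha := tendsto_nhds_unique (hlim _ (star_mem ha))
    ((hlim _ ha).congr fun k => ((hφ k).map_star ha).symm)
  nonneg ha h0 := ge_of_tendsto' (hlim _ ha) fun k => (hφ k).nonneg ha h0
  tendsto {a b C} ha hb hC h := by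
    have hone := hlim 1 (one_mem M)
    have hdist : ∀ n k, dist (χ (a n)) (φ k (a n)) ≤ (χ 1 - φ k 1) * C := fun n k => by
      have hle : φ k 1 ≤ χ 1 := (hmono 1 (one_mem M) zero_le_one).ge_of_tendsto hone k
      refine (le_of_tendsto_of_tendsto ((hlim _ (ha n)).dist tendsto_const_nhds)
        ((hone.sub_const (φ k 1)).mul_const ‖a n‖) ?_).trans
          (mul_le_mul_of_nonneg_left (hC n) (sub_nonneg.2 hle))
      filter_upwards [eventually_ge_atTop k] with l hkl
      rw [dist_comm]
      exact dist_le_of_monotone hφ hmono (ha n) hkl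
    have hzero : Tendsto (fun k => (χ 1 - φ k 1) * C) atTop (𝓝 0) := by
      simpa only [sub_self, zero_mul] using (hone.const_sub (χ 1)).mul_const C
    have hunif : TendstoUniformly (fun k n => φ k (a n)) (fun n => χ (a n)) atTop :=
      Metric.tendstoUniformly_iff.2 fun ε hε =>
        (hzero.eventually_lt_const hε).mono fun k hk n => (hdist n k).trans_lt hk
    exact hunif.tendstoUniformlyOnFilter.mono_right le_top |>.tendsto_of_eventually_tendsto
      (.of_forall fun k => (hφ k).tendsto ha hb hC h) (hlim b hb)

end Monotone

end IsNormalPositive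

namespace TracialState

variable {M N : VonNeumannAlgebra H} {τ : TracialState N} {f : H →ₗ.[ℂ] H}

/-- The functional `y ↦ Re τ(f y)` on `N`, for `f ∈ L₁(N, τ)₊`, as a limit over the truncations
of `f`. -/
def l1Functional (τ : TracialState N) (f : H →ₗ.[ℂ] H) (y : H →L[ℂ] H) : ℝ :=
  limUnder atTop fun k : ℕ => τ.re (truncation f k * y)

namespace MemL1Pos

variable (hf : τ.MemL1Pos N f)
include hf

theorem isNormalPositive_re_truncation_mul (k : ℕ) :
    IsNormalPositive N fun y => τ.re (truncation f k * y) := by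
  obtain ⟨R, hRN, hR⟩ := hf.exists_isPosResolvent
  rw [hR.truncation_eq k.cast_nonneg]
  exact τ.isNormalPositive_re_mul (truncOp_mem hRN k)
    (truncOp_nonneg hR.nonneg hR.le_one k.cast_nonneg)

theorem monotone_re_truncation_mul (y : H →L[ℂ] H) (hy : y ∈ N) (hy0 : 0 ≤ y) :
    Monotone fun k : ℕ => τ.re (truncation f k * y) := by
  obtain ⟨R, hRN, hR⟩ := hf.exists_isPosResolvent
  simp only [hR.truncation_eq (Nat.cast_nonneg _)]
  exact fun k l h => τ.re_mul_mono_left (truncOp_mem hRN _) (truncOp_mem hRN _) hy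
    (truncOp_mono hR.nonneg hR.le_one (Nat.cast_nonneg _) (Nat.cast_le.2 h)) hy0

theorem bddAbove_re_truncation : BddAbove (Set.range fun k : ℕ => τ.re (truncation f k * 1)) := by
  refine ⟨(τ.traceMul f 1).toReal, ?_⟩
  rintro _ ⟨k, rfl⟩
  rw [← ENNReal.ofReal_le_iff_le_toReal hf.trace_lt_top.ne]
  exact le_iSup (fun k : ℕ => ENNReal.ofReal (τ.re (truncation f k * 1))) k

theorem tendsto_l1Functional (y : H →L[ℂ] H) (hy : y ∈ N) :
    Tendsto (fun k : ℕ => τ.re (truncation f k * y)) atTop (𝓝 (τ.l1Functional f y)) :=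
  tendsto_nhds_limUnder (IsNormalPositive.exists_tendsto_of_monotone
    hf.isNormalPositive_re_truncation_mul hf.monotone_re_truncation_mul
    hf.bddAbove_re_truncation hy)

theorem traceMul_eq_ofReal {y : H →L[ℂ] H} (hy : y ∈ N) (hy0 : 0 ≤ y) :
    τ.traceMul f y = ENNReal.ofReal (τ.l1Functional f y) :=
  iSup_eq_of_tendsto
    (fun _ _ h => ENNReal.ofReal_le_ofReal (hf.monotone_re_truncation_mul y hy hy0 h))
    (ENNReal.tendsto_ofReal (hf.tendsto_l1Functional y hy))

theorem isNormalPositive_l1Functional : IsNormalPositive N (τ.l1Functional f) :=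
  .of_monotone hf.isNormalPositive_re_truncation_mul hf.monotone_re_truncation_mul
    hf.tendsto_l1Functional

end MemL1Pos

end TracialState

section WeakLimits

variable {M N : VonNeumannAlgebra H} {ι : Type*}

theorem exists_tendsto_inner_ultrafilter (U : Ultrafilter ι) {a : ι → H →L[ℂ] H} {C : ℝ}
    (hC : ∀ i, ‖a i‖ ≤ C) :
    ∃ b : H →L[ℂ] H, ∀ x y, Tendsto (fun i => inner ℂ (a i x) y) U (𝓝 (inner ℂ (b x) y)) := by
  have hbound : ∀ x y i, ‖inner ℂ (a i x) y‖ ≤ C * ‖x‖ * ‖y‖ := fun x y i =>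
    (norm_inner_le_norm _ _).trans (by gcongr; exact (a i).le_of_opNorm_le (hC i) x)
  have hlim : ∀ x y, ∃ z, Tendsto (fun i => inner ℂ (a i x) y) U (𝓝 z) := fun x y => by
    obtain ⟨z, -, hz⟩ := (isCompact_closedBall (0 : ℂ) (C * ‖x‖ * ‖y‖)).ultrafilter_le_nhds
      (U.map fun i => inner ℂ (a i x) y)
      (le_principal_iff.2 (mem_map.2 (univ_mem' fun i => by simpa using hbound x y i)))
    exact ⟨z, hz⟩
  choose B hB using hlim
  let form : H →ₗ⋆[ℂ] H →ₗ[ℂ] ℂ := LinearMap.mk₂'ₛₗ _ _ B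
    (fun x x' y => tendsto_nhds_unique (hB _ _)
      (by simpa only [map_add, inner_add_left] using (hB x y).add (hB x' y)))
    (fun c x y => tendsto_nhds_unique (hB _ _)
      (by simpa only [map_smul, inner_smul_left, smul_eq_mul] using (hB x y).const_mul _))
    (fun x y y' => tendsto_nhds_unique (hB _ _)
      (by simpa only [inner_add_right] using (hB x y).add (hB x y')))
    (fun c x y => tendsto_nhds_unique (hB _ _)
      (by simpa only [inner_smul_right, smul_eq_mul, RingHom.id_apply] using (hB x y).const_mul c))
  have hform : ∀ x y, ‖form x y‖ ≤ C * ‖x‖ * ‖y‖ := fun x y =>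
    le_of_tendsto' (hB x y).norm (hbound x y)
  refine ⟨InnerProductSpace.continuousLinearMapOfBilin (form.mkContinuous₂ C hform), fun x y => ?_⟩
  rw [InnerProductSpace.continuousLinearMapOfBilin_apply]
  exact hB x y

theorem mem_of_tendsto_inner {l : Filter ι} [l.NeBot] {a : ι → H →L[ℂ] H} {b : H →L[ℂ] H}
    (ha : ∀ i, a i ∈ M)
    (h : ∀ x y, Tendsto (fun i => inner ℂ (a i x) y) l (𝓝 (inner ℂ (b x) y))) : b ∈ M := by
  refine mem_of_forall_commute fun u hu => ContinuousLinearMap.ext fun x => ?_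
  refine ext_inner_right ℂ fun y => tendsto_nhds_unique ?_ (h (u x) y)
  rw [mul_apply_eq_comp, ← ContinuousLinearMap.adjoint_inner_right]
  refine (h x _).congr fun i => ?_
  rw [ContinuousLinearMap.adjoint_inner_right]
  exact congrArg (inner ℂ · y) (DFunLike.congr_fun (commute_of_mem_commutant (ha i) hu).eq x)

omit [CompleteSpace H] in
theorem nonneg_of_tendsto_inner {l : Filter ι} [l.NeBot] {a : ι → H →L[ℂ] H} {b : H →L[ℂ] H}
    (ha : ∀ i, 0 ≤ a i)
    (h : ∀ x, Tendsto (fun i => inner ℂ (a i x) x) l (𝓝 (inner ℂ (b x) x))) : 0 ≤ b :=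
  nonneg_of_dense dense_univ fun x _ => ge_of_tendsto' (h x) fun i =>
    ((ContinuousLinearMap.nonneg_iff_isPositive _).1 (ha i)).inner_nonneg_left x

omit [CompleteSpace H] in
theorem tendsto_mul_apply {l : Filter ι} {a b : ι → H →L[ℂ] H} {a' b' : H →L[ℂ] H} {C : ℝ}
    (hC : ∀ i, ‖a i‖ ≤ C) (ha : ∀ y, Tendsto (fun i => a i y) l (𝓝 (a' y)))
    (hb : ∀ y, Tendsto (fun i => b i y) l (𝓝 (b' y))) (y : H) :
    Tendsto (fun i => (a i * b i) y) l (𝓝 ((a' * b') y)) := by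
  have hnorm : Tendsto (fun i => C * ‖b i y - b' y‖) l (𝓝 0) := by
    simpa only [mul_zero] using (tendsto_iff_norm_sub_tendsto_zero.1 (hb y)).const_mul C
  have herror : Tendsto (fun i => a i (b i y - b' y)) l (𝓝 0) :=
    squeeze_zero_norm (fun i => (a i).le_of_opNorm_le (hC i) _) hnorm
  simpa only [zero_add, map_sub, sub_add_cancel, mul_apply_eq_comp] using herror.add (ha (b' y))

end WeakLimits

namespace TracialState

variable {M N : VonNeumannAlgebra H} (τ : TracialState N) {ι : Type*} {l : Filter ι}
  {a : ι → H →L[ℂ] H} {C : ℝ}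

/- By normality, a weak limit point of `a` is a positive operator of trace zero, and `τ` is
faithful. -/
theorem tendsto_inner_zero_of_tendsto_re (ha : ∀ i, a i ∈ N) (h0 : ∀ i, 0 ≤ a i)
    (hC : ∀ i, ‖a i‖ ≤ C) (h : Tendsto (fun i => τ.re (a i)) l (𝓝 0)) (x y : H) :
    Tendsto (fun i => inner ℂ (a i x) y) l (𝓝 0) := by
  refine (tendsto_iff_ultrafilter _ _ _).2 fun U hU => ?_
  obtain ⟨b, hb⟩ := exists_tendsto_inner_ultrafilter U hC
  have hbN : b ∈ N := mem_of_tendsto_inner ha hb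
  have hb0 : 0 ≤ b := nonneg_of_tendsto_inner h0 fun x => hb x x
  have hre : Tendsto (fun i => τ.re (a i)) U (𝓝 (τ.re b)) :=
    τ.tendsto_re_of_tendsto_inner ha hbN hC fun x y => by
      simpa only [Function.comp_def, inner_conj_symm] using
        (Complex.continuous_conj.tendsto _).comp (hb y x)
  have hzero : b = 0 :=
    τ.eq_zero_of_re_eq_zero hbN hb0 (tendsto_nhds_unique hre (h.mono_left hU))
  simpa only [hzero, _root_.zero_apply, inner_zero_left] using hb x y

theorem tendsto_apply_zero_of_tendsto_re (ha : ∀ i, a i ∈ N) (hC : ∀ i, ‖a i‖ ≤ C)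
    (h : Tendsto (fun i => τ.re (star (a i) * a i)) l (𝓝 0)) (y : H) :
    Tendsto (fun i => a i y) l (𝓝 0) := by
  have hinner := τ.tendsto_inner_zero_of_tendsto_re (fun i => mul_mem (star_mem (ha i)) (ha i))
    (fun i => star_mul_self_nonneg (a i))
    (fun i => norm_mul_le_of_le ((norm_star (a i)).trans_le (hC i)) (hC i)) h y y
  have hsq : Tendsto (fun i => ‖a i y‖ ^ 2) l (𝓝 0) := by
    refine ((Complex.continuous_re.tendsto _).comp hinner).congr fun i => ?_
    rw [Function.comp_apply, mul_apply_eq_comp, ContinuousLinearMap.star_eq_adjoint,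
      ContinuousLinearMap.adjoint_inner_left]
    exact (norm_sq_eq_re_inner (𝕜 := ℂ) _).symm
  rw [tendsto_zero_iff_norm_tendsto_zero]
  simpa using hsq.sqrt

theorem exists_tendsto_apply_of_tendsto_re (hM : M ≤ N) {a : ℕ → H →L[ℂ] H}
    (ha : ∀ n, a n ∈ M) (hC : ∀ n, ‖a n‖ ≤ C)
    (h : Tendsto (fun p : ℕ × ℕ => τ.re (star (a p.1 - a p.2) * (a p.1 - a p.2))) atTop (𝓝 0)) :
    ∃ b ∈ M, ∀ y, Tendsto (fun n => a n y) atTop (𝓝 (b y)) := by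
  have hsub := τ.tendsto_apply_zero_of_tendsto_re (a := fun p : ℕ × ℕ => a p.1 - a p.2)
    (C := C + C) (fun p => hM (sub_mem (ha p.1) (ha p.2)))
    (fun p => (norm_sub_le _ _).trans (add_le_add (hC p.1) (hC p.2))) h
  have hlim : ∀ y, ∃ z, Tendsto (fun n => a n y) atTop (𝓝 z) := fun y =>
    cauchySeq_tendsto_of_complete (cauchySeq_iff_tendsto_dist_atTop_0.2 (by
      simpa only [dist_eq_norm, sub_apply, norm_zero] using (hsub y).norm))
  choose b hb using hlim
  refine ⟨continuousLinearMapOfTendsto (σ₁₂ := RingHom.id ℂ) a (tendsto_pi_nhds.2 hb),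
    mem_of_tendsto_inner ha fun x y => (hb x).inner tendsto_const_nhds, hb⟩

end TracialState

section Centralizer

variable {M : VonNeumannAlgebra H} {φ : (H →L[ℂ] H) → ℝ} (hφ : IsNormalPositive M φ)
  {a b z : H →L[ℂ] H}
include hφ

namespace IsNormalPositive

theorem map_mul_comm_of_isSelfAdjoint (ha : a ∈ M) (hb : b ∈ M) (hsa : IsSelfAdjoint a)
    (hsb : IsSelfAdjoint b) : φ (a * b) = φ (b * a) := by
  rw [← hφ.map_star (mul_mem ha hb), star_mul, hsa.star_eq, hsb.star_eq]

theorem continuousOn : ContinuousOn φ {a | a ∈ M} := by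
  refine (LipschitzOnWith.of_dist_le_mul (K := (φ 1).toNNReal) fun a ha b hb => ?_).continuousOn
  rw [Real.dist_eq, dist_eq_norm, ← hφ.map_sub ha hb,
    Real.coe_toNNReal _ (hφ.nonneg (one_mem M) zero_le_one)]
  exact hφ.abs_le (sub_mem ha hb)

/-- The centralizer of a normal positive functional, as a real star algebra. -/
def centralizer : StarSubalgebra ℝ (H →L[ℂ] H) where
  carrier := {a | a ∈ M ∧ ∀ z ∈ M, φ (a * z) = φ (z * a)}
  mul_mem' {a b} ha hb := ⟨mul_mem ha.1 hb.1, fun z hz => by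
    rw [mul_assoc, ha.2 _ (mul_mem hb.1 hz), mul_assoc, hb.2 _ (mul_mem hz ha.1), mul_assoc]⟩
  add_mem' {a b} ha hb := ⟨add_mem ha.1 hb.1, fun z hz => by
    rw [add_mul, mul_add, hφ.map_add (mul_mem ha.1 hz) (mul_mem hb.1 hz),
      hφ.map_add (mul_mem hz ha.1) (mul_mem hz hb.1), ha.2 z hz, hb.2 z hz]⟩
  algebraMap_mem' r := by
    rw [Algebra.algebraMap_eq_smul_one]
    exact ⟨real_smul_mem (one_mem M) r, fun z _ => by
      rw [smul_mul_assoc, mul_smul_comm, one_mul, mul_one]⟩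
  star_mem' {a} ha := ⟨star_mem ha.1, fun z hz => by
    rw [← hφ.map_star (mul_mem (star_mem ha.1) hz), ← hφ.map_star (mul_mem hz (star_mem ha.1)),
      star_mul, star_mul, star_star, ha.2 _ (star_mem hz)]⟩

theorem isClosed_centralizer : IsClosed (hφ.centralizer : Set (H →L[ℂ] H)) := by
  refine IsSeqClosed.isClosed fun a b ha hab => ?_
  have hb : b ∈ M := (isClosed_setOf_mem M).mem_of_tendsto hab (.of_forall fun n => (ha n).1)
  have hlim : ∀ {c : ℕ → H →L[ℂ] H} {d}, (∀ n, c n ∈ M) → d ∈ M → Tendsto c atTop (𝓝 d) →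
      Tendsto (fun n => φ (c n)) atTop (𝓝 (φ d)) := fun hc hd h =>
    (hφ.continuousOn _ hd).tendsto.comp (tendsto_nhdsWithin_iff.2 ⟨h, .of_forall hc⟩)
  refine ⟨hb, fun z hz => tendsto_nhds_unique
    (hlim (fun n => mul_mem (ha n).1 hz) (mul_mem hb hz) (hab.mul_const z)) ?_⟩
  exact (hlim (fun n => mul_mem hz (ha n).1) (mul_mem hz hb) (hab.const_mul z)).congr
    fun n => ((ha n).2 z hz).symm

theorem mem_centralizer_of_mul_self (ha : 0 ≤ a) (h : a * a ∈ hφ.centralizer) :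
    a ∈ hφ.centralizer := by
  have hsqrt : cfc Real.sqrt (a * a) = a := by
    have haa : 0 ≤ a * a := (Commute.refl a).mul_nonneg ha ha
    rw [← cfcₙ_eq_cfc, ← CFC.sqrt_eq_real_sqrt (a * a) haa, CFC.sqrt_mul_self a ha]
  rw [← hsqrt]
  exact StarAlgebra.elemental.le_of_mem hφ.isClosed_centralizer h (cfc_mem_elemental _ _)

end IsNormalPositive

end Centralizer

section Energy

variable {M N : VonNeumannAlgebra H} {τ : TracialState N} {ψ : (H →L[ℂ] H) → ℝ}

/-- The quadratic functional on the self-adjoint part of a von Neumann algebra that is minimal at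
the density of `τ` with respect to `ψ`. -/
def energy (τ : TracialState N) (ψ : (H →L[ℂ] H) → ℝ) (z : H →L[ℂ] H) : ℝ :=
  ψ (z * z) - 2 * τ.re z

variable (hM : M ≤ N) (hψ : IsNormalPositive M ψ)
include hM hψ

theorem energy_add_smul {z d : H →L[ℂ] H} (hz : z ∈ M) (hd : d ∈ M) (hsz : IsSelfAdjoint z)
    (hsd : IsSelfAdjoint d) (t : ℝ) : energy τ ψ (z + t • d)
      = energy τ ψ z + 2 * t * (ψ (z * d) - τ.re d) + t ^ 2 * ψ (d * d) := by
  have hzz := mul_mem hz hz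
  have hzd := mul_mem hz hd
  have hdz := mul_mem hd hz
  have hdd := mul_mem hd hd
  have hexpand : (z + t • d) * (z + t • d)
      = z * z + t • (z * d) + (t • (d * z) + t • t • (d * d)) := by
    rw [add_mul, mul_add, mul_add, smul_mul_assoc, smul_mul_assoc, mul_smul_comm, mul_smul_comm]
  rw [energy, energy, hexpand, hψ.map_add (add_mem hzz (real_smul_mem hzd t))
      (add_mem (real_smul_mem hdz t) (real_smul_mem (real_smul_mem hdd t) t)),
    hψ.map_add hzz (real_smul_mem hzd t),
    hψ.map_add (real_smul_mem hdz t) (real_smul_mem (real_smul_mem hdd t) t), hψ.map_smul hzd,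
    hψ.map_smul hdz, hψ.map_smul (real_smul_mem hdd t), hψ.map_smul hdd,
    hψ.map_mul_comm_of_isSelfAdjoint hd hz hsd hsz, τ.re_add (hM hz) (hM (real_smul_mem hd t)),
    τ.re_smul (hM hd)]
  ring

theorem map_sub_mul_sub_le_of_energy_le {z w : H →L[ℂ] H} (hz : z ∈ M) (hw : w ∈ M)
    (hsz : IsSelfAdjoint z) (hsw : IsSelfAdjoint w) {δ ε : ℝ}
    (hzmin : ∀ x ∈ M, IsSelfAdjoint x → energy τ ψ z ≤ energy τ ψ x + δ)
    (hwmin : ∀ x ∈ M, IsSelfAdjoint x → energy τ ψ w ≤ energy τ ψ x + ε) :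
    ψ ((z - w) * (z - w)) ≤ 2 * (δ + ε) := by
  have hd := sub_mem hz hw
  have hsd := hsz.sub hsw
  have hmid := real_smul_mem hd (1 / 2)
  have hsmid : IsSelfAdjoint (w + (1 / 2 : ℝ) • (z - w)) :=
    hsw.add ((IsSelfAdjoint.all (1 / 2 : ℝ)).smul hsd)
  have h_end := energy_add_smul (τ := τ) hM hψ hw hd hsw hsd 1
  have h_mid := energy_add_smul (τ := τ) hM hψ hw hd hsw hsd (1 / 2)
  rw [one_smul, add_sub_cancel] at h_end
  linarith [hzmin _ (add_mem hw hmid) hsmid, hwmin _ (add_mem hw hmid) hsmid]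

variable (hle : ∀ a ∈ M, 0 ≤ a → τ.re a ≤ ψ a)
include hle

omit hψ in
theorem neg_one_le_energy {z : H →L[ℂ] H} (hz : z ∈ M) (hsz : IsSelfAdjoint z) :
    -1 ≤ energy τ ψ z := by
  have hsq := τ.re_nonneg (hM (mul_mem (sub_mem hz (one_mem M)) (sub_mem hz (one_mem M))))
    (hsz.sub (.one _)).mul_self_nonneg
  have hexpand : (z - 1) * (z - 1) = z * z - (2 : ℝ) • z + 1 := by
    rw [two_smul]
    noncomm_ring
  rw [hexpand, τ.re_add (hM (sub_mem (mul_mem hz hz) (real_smul_mem hz 2))) (one_mem N),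
    τ.re_sub (hM (mul_mem hz hz)) (hM (real_smul_mem hz 2)), τ.re_smul (hM hz), τ.re_one] at hsq
  rw [energy]
  linarith [hle _ (mul_mem hz hz) hsz.mul_self_nonneg]

/- With `c` the truncation of `z` to `[0, 1]` and `m = (z - 1)₊`, one has `z² - c² ≥ 2 m` and
`z - c ≤ m`. -/
theorem exists_energy_le {z : H →L[ℂ] H} (hz : z ∈ M) (hsz : IsSelfAdjoint z) :
    ∃ c ∈ M, 0 ≤ c ∧ c ≤ 1 ∧ energy τ ψ c ≤ energy τ ψ z := by
  set c := cfc (fun r : ℝ => max 0 (min r 1)) z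
  set m := cfc (fun r : ℝ => max (r - 1) 0) z
  have hc : c ∈ M := cfc_mem hz _
  have hm : m ∈ M := cfc_mem hz _
  have hm0 : 0 ≤ m := cfc_nonneg fun r _ => le_max_right _ _
  refine ⟨c, hc, cfc_nonneg fun r _ => le_max_left _ _,
    cfc_le_one _ _ fun r _ => max_le zero_le_one (min_le_right _ _), ?_⟩
  have hsq : (2 : ℝ) • m + c * c ≤ z * z := by
    have hzz : z * z = cfc (fun r : ℝ => r * r) z := by
      rw [cfc_mul (fun r : ℝ => r) (fun r : ℝ => r) z, cfc_id' ℝ z]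
    rw [hzz, ← cfc_mul _ _ z, ← cfc_smul (2 : ℝ) _ z, ← cfc_add z _ _]
    refine cfc_mono fun r _ => ?_
    rcases le_total r 0 with h | h <;> rcases le_total r 1 with h' | h' <;>
      simp only [smul_eq_mul, min_eq_left, min_eq_right, max_eq_left, max_eq_right, sub_nonneg,
        sub_nonpos, zero_le_one, h, h'] <;> nlinarith
  have hlin : z - c ≤ m := by
    conv_lhs => rw [← cfc_id' ℝ z]
    rw [← cfc_sub _ _ z]
    refine cfc_mono fun r _ => ?_
    rcases le_total r 1 with h | h
    · rw [min_eq_left h]; exact (sub_nonpos.2 (le_max_right _ _)).trans (le_max_right _ _)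
    · rw [min_eq_right h, max_eq_right zero_le_one]; exact le_max_left _ _
  have hψ_sq := hψ.mono (add_mem (real_smul_mem hm 2) (mul_mem hc hc)) (mul_mem hz hz) hsq
  have hτ_lin := τ.re_mono (hM (sub_mem hz hc)) (hM hm) hlin
  rw [hψ.map_add (real_smul_mem hm 2) (mul_mem hc hc), hψ.map_smul hm] at hψ_sq
  rw [τ.re_sub (hM hz) (hM hc)] at hτ_lin
  rw [energy, energy]
  linarith [hle m hm hm0]

theorem exists_energy_le_add {δ : ℝ} (hδ : 0 < δ) : ∃ z ∈ M, 0 ≤ z ∧ z ≤ 1 ∧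
    ∀ x ∈ M, IsSelfAdjoint x → energy τ ψ z ≤ energy τ ψ x + δ := by
  have hbdd : BddBelow (energy τ ψ '' {x | x ∈ M ∧ IsSelfAdjoint x}) :=
    ⟨-1, by rintro _ ⟨x, ⟨hx, hsx⟩, rfl⟩; exact neg_one_le_energy hM hle hx hsx⟩
  obtain ⟨_, ⟨z, ⟨hz, hsz⟩, rfl⟩, hlt⟩ := Real.lt_sInf_add_pos
    (s := energy τ ψ '' {x | x ∈ M ∧ IsSelfAdjoint x}) ⟨_, 0, ⟨zero_mem M, .zero _⟩, rfl⟩ hδ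
  obtain ⟨c, hc, hc0, hc1, hcz⟩ := exists_energy_le hM hψ hle hz hsz
  refine ⟨c, hc, hc0, hc1, fun x hx hsx => ?_⟩
  linarith [csInf_le hbdd (Set.mem_image_of_mem _ ⟨hx, hsx⟩)]

/- A minimizing sequence is Cauchy in the 2-norm of `τ`, hence strongly convergent. -/
theorem exists_forall_energy_le : ∃ R ∈ M, 0 ≤ R ∧ R ≤ 1 ∧
    ∀ x ∈ M, IsSelfAdjoint x → energy τ ψ R ≤ energy τ ψ x := by
  choose z hz hz0 hz1 hzmin using fun n : ℕ =>
    exists_energy_le_add (τ := τ) hM hψ hle (Nat.one_div_pos_of_nat (α := ℝ) (n := n))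
  have hsz : ∀ n, IsSelfAdjoint (z n) := fun n => .of_nonneg (hz0 n)
  have hnorm : ∀ n, ‖z n‖ ≤ 1 := fun n =>
    (CStarAlgebra.norm_le_one_iff_of_nonneg _ (hz0 n)).2 (hz1 n)
  have hδ : Tendsto (fun n : ℕ => 1 / ((n : ℝ) + 1)) atTop (𝓝 0) :=
    tendsto_one_div_add_atTop_nhds_zero_nat
  have hcauchy : Tendsto (fun p : ℕ × ℕ => τ.re (star (z p.1 - z p.2) * (z p.1 - z p.2)))
      atTop (𝓝 0) := by
    have hsum : Tendsto (fun p : ℕ × ℕ => 2 * (1 / ((p.1 : ℝ) + 1) + 1 / ((p.2 : ℝ) + 1)))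
        atTop (𝓝 0) := by
      rw [← prod_atTop_atTop_eq]
      simpa using ((hδ.comp tendsto_fst).add (hδ.comp tendsto_snd)).const_mul 2
    refine squeeze_zero (fun p => τ.re_nonneg ?_ (star_mul_self_nonneg _)) (fun p => ?_) hsum
    · exact hM (mul_mem (star_mem (sub_mem (hz _) (hz _))) (sub_mem (hz _) (hz _)))
    · have hsd := (hsz p.1).sub (hsz p.2)
      rw [hsd.star_eq]
      exact (hle _ (mul_mem (sub_mem (hz _) (hz _)) (sub_mem (hz _) (hz _)))
        hsd.mul_self_nonneg).trans (map_sub_mul_sub_le_of_energy_le hM hψ (hz _) (hz _) (hsz _)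
          (hsz _) (hzmin _) (hzmin _))
  obtain ⟨R, hR, hlim⟩ := τ.exists_tendsto_apply_of_tendsto_re hM hz hnorm hcauchy
  have henergy : Tendsto (fun n => energy τ ψ (z n)) atTop (𝓝 (energy τ ψ R)) :=
    (hψ.tendsto (fun n => mul_mem (hz n) (hz n)) (mul_mem hR hR)
      (fun n => norm_mul_le_of_le (hnorm n) (hnorm n)) (tendsto_mul_apply hnorm hlim hlim)).sub
      ((τ.tendsto_re (fun n => hM (hz n)) (hM hR) hnorm hlim).const_mul 2)
  refine ⟨R, hR, nonneg_of_tendsto_inner hz0 fun x => (hlim x).inner tendsto_const_nhds,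
    sub_nonneg.1 (nonneg_of_tendsto_inner (fun n => sub_nonneg.2 (hz1 n)) fun x =>
      (tendsto_const_nhds.sub (hlim x)).inner tendsto_const_nhds), fun x hx hsx => ?_⟩
  refine le_of_tendsto_of_tendsto' henergy ?_ fun n => hzmin n x hx hsx
  simpa only [add_zero] using hδ.const_add (energy τ ψ x)

omit hle in
theorem map_mul_add_mul_eq_of_forall_energy_le {R d : H →L[ℂ] H} (hR : R ∈ M)
    (hsR : IsSelfAdjoint R) (hmin : ∀ x ∈ M, IsSelfAdjoint x → energy τ ψ R ≤ energy τ ψ x)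
    (hd : d ∈ M) : ψ (R * d + d * R) = 2 * τ.re d := by
  have hstationary : ∀ s ∈ M, IsSelfAdjoint s → ψ (R * s) = τ.re s := fun s hs hss => by
    have hdiscrim := discrim_le_zero (a := ψ (s * s)) (b := 2 * (ψ (R * s) - τ.re s)) (c := 0)
      fun t => by
        have h := hmin _ (add_mem hR (real_smul_mem hs t))
          (hsR.add ((IsSelfAdjoint.all t).smul hss))
        rw [energy_add_smul hM hψ hR hs hsR hss] at h
        linarith
    rw [discrim, mul_zero, sub_zero] at hdiscrim
    linarith [pow_eq_zero_iff two_ne_zero |>.1 (le_antisymm hdiscrim (sq_nonneg _))]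
  have hds := star_mem hd
  have h := hstationary _ (add_mem hd hds) (.add_star_self d)
  rw [mul_add, hψ.map_add (mul_mem hR hd) (mul_mem hR hds), ← hψ.map_star (mul_mem hR hds),
    star_mul, star_star, hsR.star_eq, τ.re_add (hM hd) (hM hds), τ.re_star (hM hd)] at h
  rw [hψ.map_add (mul_mem hR hd) (mul_mem hd hR), h, two_mul]

/- Testing the stationarity of the minimizer `R` on `R z - z R` gives `ψ (R² z) = ψ (z R²)`. -/
theorem exists_forall_map_mul_eq_re : ∃ R ∈ M, 0 ≤ R ∧ R ≤ 1 ∧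
    ∀ z ∈ M, ψ (R * z) = τ.re z := by
  obtain ⟨R, hR, hR0, hR1, hmin⟩ := exists_forall_energy_le (τ := τ) hM hψ hle
  have hstationary : ∀ d ∈ M, ψ (R * d + d * R) = 2 * τ.re d := fun d hd =>
    map_mul_add_mul_eq_of_forall_energy_le hM hψ hR (.of_nonneg hR0) hmin hd
  have hsq : R * R ∈ hψ.centralizer := by
    refine ⟨mul_mem hR hR, fun z hz => ?_⟩
    have hRz := mul_mem hR hz
    have hzR := mul_mem hz hR
    have h := hstationary _ (sub_mem hRz hzR)
    rw [τ.re_sub (hM hRz) (hM hzR), τ.re_mul_comm (hM hR) (hM hz), sub_self, mul_zero,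
      show R * (R * z - z * R) + (R * z - z * R) * R = R * R * z - z * (R * R) by noncomm_ring,
      hψ.map_sub (mul_mem (mul_mem hR hR) hz) (mul_mem hz (mul_mem hR hR))] at h
    exact sub_eq_zero.1 h
  have hcent := hψ.mem_centralizer_of_mul_self hR0 hsq
  refine ⟨R, hR, hR0, hR1, fun z hz => ?_⟩
  have h := hstationary z hz
  rw [hψ.map_add (mul_mem hR hz) (mul_mem hz hR), ← hcent.2 z hz] at h
  linarith

end Energy

theorem IsNormalPositive.exists_density {M N : VonNeumannAlgebra H} {φ : (H →L[ℂ] H) → ℝ}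
    (hφ : IsNormalPositive M φ) (τ : TracialState N) (hM : M ≤ N) :
    ∃ R ∈ M, 0 ≤ R ∧ R ≤ 1 ∧ Function.Injective R ∧ ∀ z ∈ M, φ (R * z) = τ.re ((1 - R) * z) := by
  have hψ := (τ.isNormalPositive hM).add hφ
  obtain ⟨R, hR, hR0, hR1, hden⟩ := exists_forall_map_mul_eq_re (τ := τ) hM hψ
    fun a ha h0 => le_add_of_nonneg_right (hφ.nonneg ha h0)
  refine ⟨R, hR, hR0, hR1, (injective_iff_map_eq_zero R).2 fun y hy => ?_, fun z hz => ?_⟩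
  · have hker := proj_ker_mem hR
    have htrace := hden _ hker
    rw [mul_proj_ker, hψ.map_zero] at htrace
    have hzero := τ.eq_zero_of_re_eq_zero (hM hker) (isStarProjection_proj _).nonneg htrace.symm
    rw [← proj_apply_of_mem (K := R.toLinearMap.ker) hy, hzero, _root_.zero_apply]
  · rw [sub_mul, one_mul, τ.re_sub (hM hz) (hM (mul_mem hR hz)), ← hden z hz, add_sub_cancel_left]

/-- The operator `R⁻¹ - 1`, for injective `R`. -/
def ofResolvent (R : H →L[ℂ] H) (hinj : Function.Injective R) : H →ₗ.[ℂ] H where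
  domain := R.toLinearMap.range
  toFun := (LinearEquiv.ofInjective R.toLinearMap hinj).symm.toLinearMap
    - R.toLinearMap.range.subtype

section OfResolvent

variable {R : H →L[ℂ] H} (hinj : Function.Injective R)

omit [CompleteSpace H] in
theorem mem_domain_ofResolvent (y : H) : R y ∈ (ofResolvent R hinj).domain := ⟨y, rfl⟩

omit [CompleteSpace H] in
theorem ofResolvent_apply (y : H) :
    ofResolvent R hinj ⟨R y, mem_domain_ofResolvent hinj y⟩ = y - R y :=
  congrArg (· - R y) ((LinearEquiv.ofInjective R.toLinearMap hinj).symm_apply_apply y)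

omit [CompleteSpace H] in
theorem isResolvent_ofResolvent : IsResolvent (ofResolvent R hinj) R := by
  have hadd : ∀ y, R y + ofResolvent R hinj ⟨R y, mem_domain_ofResolvent hinj y⟩ = y := fun y => by
    rw [ofResolvent_apply, add_sub_cancel]
  refine ⟨fun y => ⟨mem_domain_ofResolvent hinj y, hadd y⟩, ?_⟩
  rintro ⟨_, y, rfl⟩
  exact congrArg R (hadd y)

theorem dense_domain_ofResolvent (hR : IsSelfAdjoint R) :
    Dense ((ofResolvent R hinj).domain : Set H) :=
  denseRange_of_isSelfAdjoint hR hinj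

theorem apply_adjoint_ofResolvent_add (hR : IsSelfAdjoint R)
    (y : (ofResolvent R hinj).adjoint.domain) : R ((ofResolvent R hinj).adjoint y + y) = y := by
  refine ext_inner_right ℂ fun z => ?_
  have h : inner ℂ ((ofResolvent R hinj).adjoint y) (R z)
      = inner ℂ (y : H) (ofResolvent R hinj ⟨R z, mem_domain_ofResolvent hinj z⟩) :=
    LinearPMap.adjoint_isFormalAdjoint (dense_domain_ofResolvent hinj hR) y
      ⟨R z, mem_domain_ofResolvent hinj z⟩
  rw [ofResolvent_apply, inner_sub_right] at h
  rw [hR.isSymmetric.apply_clm, inner_add_left, h, sub_add_cancel]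

theorem isSelfAdjoint_ofResolvent (hR : IsSelfAdjoint R) : IsSelfAdjoint (ofResolvent R hinj) := by
  have hformal : (ofResolvent R hinj).IsFormalAdjoint (ofResolvent R hinj) := by
    rintro ⟨_, y, rfl⟩ ⟨_, z, rfl⟩
    change inner ℂ (ofResolvent R hinj ⟨R y, mem_domain_ofResolvent hinj y⟩) (R z)
      = inner ℂ (R y) (ofResolvent R hinj ⟨R z, mem_domain_ofResolvent hinj z⟩)
    rw [ofResolvent_apply, ofResolvent_apply, inner_sub_left, inner_sub_right,
      hR.isSymmetric.apply_clm y z]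
  have hle : (ofResolvent R hinj).adjoint ≤ ofResolvent R hinj := by
    refine ⟨fun y hy => ⟨_, apply_adjoint_ofResolvent_add hinj hR ⟨y, hy⟩⟩, ?_⟩
    rintro y ⟨_, z, rfl⟩ h
    have hz : (ofResolvent R hinj).adjoint y + y = z :=
      hinj ((apply_adjoint_ofResolvent_add hinj hR y).trans h)
    rw [h] at hz
    exact (eq_sub_of_add_eq hz).trans (ofResolvent_apply hinj z).symm
  exact LinearPMap.isSelfAdjoint_def.2 (hle.antisymm
    (hformal.le_adjoint (dense_domain_ofResolvent hinj hR)))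

theorem re_inner_ofResolvent_nonneg (h0 : 0 ≤ R) (h1 : R ≤ 1) (x : (ofResolvent R hinj).domain) :
    0 ≤ (inner ℂ (ofResolvent R hinj x) (x : H)).re := by
  obtain ⟨_, y, rfl⟩ := x
  change 0 ≤ (inner ℂ (ofResolvent R hinj ⟨R y, mem_domain_ofResolvent hinj y⟩) (R y)).re
  rw [ofResolvent_apply]
  have hmul : 0 ≤ R * (1 - R) :=
    ((Commute.one_right R).sub_right (.refl R)).mul_nonneg h0 (sub_nonneg.2 h1)
  have h := ((ContinuousLinearMap.nonneg_iff_isPositive _).1 hmul).re_inner_nonneg_left y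
  rwa [mul_apply_eq_comp, (IsSelfAdjoint.of_nonneg h0).isSymmetric.apply_clm] at h

theorem affiliated_ofResolvent {M : VonNeumannAlgebra H} (hR : R ∈ M) :
    Affiliated M (ofResolvent R hinj) := by
  rintro u hu ⟨_, y, rfl⟩
  have hcomm : R (u y) = u (R y) := (DFunLike.congr_fun (commute_of_mem_commutant hR hu).eq y).symm
  have hsub : (⟨u (R y), ⟨u y, hcomm⟩⟩ : (ofResolvent R hinj).domain) = ⟨R (u y), ⟨u y, rfl⟩⟩ :=
    Subtype.ext hcomm.symm
  refine ⟨⟨u y, hcomm⟩, ?_⟩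
  calc ofResolvent R hinj ⟨u (R y), ⟨u y, hcomm⟩⟩ = u y - R (u y) := by
        rw [hsub]; exact ofResolvent_apply hinj (u y)
    _ = u (y - R y) := by rw [map_sub, hcomm]
    _ = u (ofResolvent R hinj ⟨R y, mem_domain_ofResolvent hinj y⟩) := by
        rw [ofResolvent_apply]

end OfResolvent

section CondExp

variable {M N : VonNeumannAlgebra H} {τ : TracialState N} {φ : (H →L[ℂ] H) → ℝ}
  {R x : H →L[ℂ] H} {f : H →ₗ.[ℂ] H}

theorem TracialState.re_truncOp_mul_eq (hR : R ∈ M) (h0 : 0 ≤ R)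
    (hden : ∀ z ∈ M, φ (R * z) = τ.re ((1 - R) * z)) (hx : x ∈ M) {t : ℝ} (ht : 0 ≤ t) :
    τ.re (truncOp R t * x) = φ (specProj R t * x) := by
  have hinv : R * (specInv R t * specProj R t) = specProj R t := by
    rw [← mul_assoc, mul_specInv_mul_specProj h0 ht]
  have htrunc : truncOp R t * x = (1 - R) * (specInv R t * specProj R t * x) := by
    rw [truncOp, ← mul_assoc, sub_mul 1 R, hinv, sub_mul, one_mul, one_mul]
  rw [htrunc, ← hden _ (mul_mem (mul_mem (specInv_mem hR t) (specProj_mem hR t)) hx), ← mul_assoc,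
    hinv]

theorem IsNormalPositive.traceMul_ofResolvent (hφ : IsNormalPositive M φ) (hM : M ≤ N)
    (hR : R ∈ M) (h0 : 0 ≤ R) (h1 : R ≤ 1) (hinj : Function.Injective R)
    (hden : ∀ z ∈ M, φ (R * z) = τ.re ((1 - R) * z)) (hx : x ∈ M) (hx0 : 0 ≤ x) :
    τ.traceMul (ofResolvent R hinj) x = ENNReal.ofReal (φ x) := by
  have hRpos : IsPosResolvent (ofResolvent R hinj) R := ⟨isResolvent_ofResolvent hinj, h0, h1⟩
  rw [hRpos.traceMul_eq]
  refine iSup_eq_of_tendsto (fun k l hkl => ENNReal.ofReal_le_ofReal ?_)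
    (ENNReal.tendsto_ofReal ?_)
  · exact τ.re_mul_mono_left (truncOp_mem (hM hR) _) (truncOp_mem (hM hR) _) (hM hx)
      (truncOp_mono h0 h1 k.cast_nonneg (Nat.cast_le.2 hkl)) hx0
  · refine (hφ.tendsto (fun k : ℕ => mul_mem (specProj_mem hR k) hx) hx
      (fun k => norm_mul_le_of_le (IsStarProjection.norm_le _ isStarProjection_specProj) le_rfl)
      fun y => tendsto_specProj h0 hinj (x y)).congr fun k =>
        (TracialState.re_truncOp_mul_eq hR h0 hden hx k.cast_nonneg).symm

theorem TracialState.MemL1Pos.exists_isCondExp (hf : τ.MemL1Pos N f) (hM : M ≤ N) :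
    ∃ g, τ.IsCondExp M f g := by
  have hφ := hf.isNormalPositive_l1Functional.restrict hM
  obtain ⟨R, hR, h0, h1, hinj, hden⟩ := hφ.exists_density τ hM
  have htrace : ∀ x ∈ M, 0 ≤ x → τ.traceMul (ofResolvent R hinj) x = τ.traceMul f x :=
    fun x hx hx0 => by
      rw [hφ.traceMul_ofResolvent hM hR h0 h1 hinj hden hx hx0, hf.traceMul_eq_ofReal (hM hx) hx0]
  refine ⟨ofResolvent R hinj, ⟨isSelfAdjoint_ofResolvent hinj (.of_nonneg h0),
    re_inner_ofResolvent_nonneg hinj h0 h1, affiliated_ofResolvent hinj hR, ?_⟩, htrace⟩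
  rw [htrace 1 (one_mem M) zero_le_one]
  exact hf.trace_lt_top

theorem TracialState.MemL1Pos.isCondExp_condExp (hf : τ.MemL1Pos N f) (hM : M ≤ N) :
    τ.IsCondExp M f (τ.condExp M f) := by
  have h := hf.exists_isCondExp hM
  rw [condExp, dif_pos h]
  exact h.choose_spec

end CondExp

section Compress

variable {N : VonNeumannAlgebra H} (τ : TracialState N) {g : H →ₗ.[ℂ] H} {b e q u R R' : H →L[ℂ] H}
  {s t : ℝ}

omit [CompleteSpace H] in
theorem algCompress_apply (x : (algCompress q g).domain) :
    algCompress q g x = q (g ⟨q x, x.2⟩) := rfl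

omit [CompleteSpace H] in
theorem commutesWith_algCompress (hu : CommutesWith u g) (huq : Commute u q) :
    CommutesWith u (algCompress q g) := by
  intro x
  obtain ⟨h, hgu⟩ := hu ⟨q x, x.2⟩
  have hswap : ∀ y, q (u y) = u (q y) := fun y => (DFunLike.congr_fun huq.eq y).symm
  have hx : q (u x) ∈ g.domain := by rwa [hswap]
  refine ⟨hx, ?_⟩
  rw [algCompress_apply, algCompress_apply, ← hswap, ← hgu]
  congr 2
  exact Subtype.ext (hswap x)

omit [CompleteSpace H] in
theorem commutesWith_algCompress_self (hq : IsIdempotentElem q) :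
    CommutesWith q (algCompress q g) := by
  intro x
  have hqq : ∀ y, q (q y) = q y := DFunLike.congr_fun hq.eq
  have hx : q (q x) ∈ g.domain := by
    rw [hqq]
    exact x.2
  refine ⟨hx, ?_⟩
  rw [algCompress_apply, algCompress_apply, hqq (g _)]
  congr 2
  exact Subtype.ext (hqq x)

theorem TracialState.dense_of_one_le_re_proj {L : Submodule ℂ H} (hL : proj L ∈ N)
    (h : 1 ≤ τ.re (proj L)) : Dense (L : Set H) := by
  intro x
  simpa only [τ.eq_one_of_one_le_re hL (isStarProjection_proj L) h, one_apply_eq_self]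
    using proj_apply_mem_closure L x

omit [CompleteSpace H] in
theorem ker_one_add_mul (hb : 0 ≤ b) :
    ((1 + b) * e).toLinearMap.ker = e.toLinearMap.ker := by
  ext x
  change (1 + b) (e x) = 0 ↔ e x = 0
  refine ⟨fun h => ?_, fun h => by rw [h, map_zero]⟩
  have hpos : 0 ≤ (inner ℂ (b (e x)) (e x)).re :=
    ((ContinuousLinearMap.nonneg_iff_isPositive _).1 hb).re_inner_nonneg_left _
  have hsum : (inner ℂ ((1 + b) (e x)) (e x)).re = 0 := by rw [h, inner_zero_left, Complex.zero_re]
  rw [add_apply, one_apply_eq_self, inner_add_left, Complex.add_re] at hsum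
  refine (re_inner_self_nonpos (𝕜 := ℂ)).1 ?_
  change (inner ℂ (e x) (e x)).re ≤ 0
  linarith

/- The polar decomposition of `(1 + b) e`, an injective operator on the range of `e`, makes `e`
equivalent to its range projection. -/
theorem TracialState.re_le_re_proj_range_one_add_mul (hb : b ∈ N) (hb0 : 0 ≤ b) (he : e ∈ N)
    (hp : IsStarProjection e) : τ.re e ≤ τ.re (proj ((1 + b) * e).toLinearMap.range) := by
  set a := (1 + b) * e
  have ha : a ∈ N := mul_mem (add_mem (one_mem N) hb) he
  have hinitial : proj (star a).toLinearMap.range = e := by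
    rw [← one_sub_proj_ker, ker_one_add_mul hb0, one_sub_proj_ker, hp.isSelfAdjoint.star_eq,
      proj_range_of_isStarProjection hp]
  have hstar : star a * proj a.toLinearMap.range = star a := by
    simpa only [star_mul, (isStarProjection_proj _).isSelfAdjoint.star_eq]
      using congrArg star (proj_range_mul a)
  simpa only [hinitial] using
    τ.re_proj_range_le (star_mem ha) (proj_range_mem ha) (isStarProjection_proj _) hstar

/-- The vectors `x` such that `q x` is in the range of the spectral projection `1_{[0,t]}(g)`, where
`R` is the resolvent of `g`. For increasing `t` these subspaces exhaust a core of `q g q`. -/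
def compressCore (q R : H →L[ℂ] H) (t : ℝ) : Submodule ℂ H :=
  ((1 - specProj R t) * q).toLinearMap.ker

theorem specProj_apply_of_mem_compressCore {x : H} (hx : x ∈ compressCore q R t) :
    specProj R t (q x) = q x := by
  have h : (1 - specProj R t) (q x) = 0 := hx
  rwa [sub_apply, one_apply_eq_self, sub_eq_zero, eq_comm] at h

theorem exists_algCompress_apply_eq (hR : IsPosResolvent g R) (ht : 0 ≤ t) {x : H}
    (hx : x ∈ compressCore q R t) :
    ∃ h : x ∈ (algCompress q g).domain, algCompress q g ⟨x, h⟩ = (q * truncOp R t * q) x := by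
  obtain ⟨h, hgx⟩ := hR.exists_apply_eq_truncOp ht (specProj_apply_of_mem_compressCore hx)
  exact ⟨h, congrArg q hgx⟩

theorem proj_compressCore_mem (hRN : R ∈ N) (hqN : q ∈ N) : proj (compressCore q R t) ∈ N :=
  proj_ker_mem (mul_mem (sub_mem (one_mem N) (specProj_mem hRN t)) hqN)

theorem TracialState.one_sub_le_re_proj_compressCore (hRN : R ∈ N) (hqN : q ∈ N) :
    1 - τ.re (1 - specProj R t) ≤ τ.re (proj (compressCore q R t)) := by
  have he : IsStarProjection (1 - specProj R t) := isStarProjection_specProj.one_sub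
  have heN : 1 - specProj R t ∈ N := sub_mem (one_mem N) (specProj_mem hRN t)
  have h := τ.re_proj_range_le (star_mem (mul_mem heN hqN)) heN he (by
    rw [star_mul, he.isSelfAdjoint.star_eq, mul_assoc, he.isIdempotentElem.eq])
  rw [← one_sub_proj_ker, τ.re_sub (one_mem N) (proj_ker_mem (mul_mem heN hqN)), τ.re_one] at h
  rw [compressCore]
  linarith

theorem TracialState.dense_of_one_sub_le (hR : IsPosResolvent g R) (hRN : R ∈ N)
    {L : Submodule ℂ H} (hL : ∀ u ∈ N.commutant, ∀ x ∈ L, u x ∈ L)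
    (h : ∀ k : ℕ, 1 - τ.re (1 - specProj R k) ≤ τ.re (proj L)) : Dense (L : Set H) := by
  have hlim := (τ.tendsto_re_one_sub_specProj hRN hR.nonneg
    hR.isResolvent.injective).const_sub 1
  rw [sub_zero] at hlim
  exact τ.dense_of_one_le_re_proj (proj_mem hL) (le_of_tendsto hlim (.of_forall h))

include τ in
theorem dense_domain_algCompress (hR : IsPosResolvent g R) (hRN : R ∈ N) (hg : Affiliated N g)
    (hqN : q ∈ N) : Dense ((algCompress q g).domain : Set H) := by
  have hinv : ∀ u ∈ N.commutant, ∀ x ∈ (algCompress q g).domain, u x ∈ (algCompress q g).domain :=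
    fun u hu x hx =>
      (commutesWith_algCompress (hg u hu) (commute_of_mem_commutant hqN hu) ⟨x, hx⟩).1
  refine τ.dense_of_one_sub_le hR hRN hinv fun k => ?_
  refine (τ.one_sub_le_re_proj_compressCore hRN hqN).trans
    (τ.re_mono (proj_compressCore_mem hRN hqN) (proj_mem hinv) (proj_mono fun x hx => ?_))
  exact (exists_algCompress_apply_eq hR (Nat.cast_nonneg k) hx).1

theorem conjugate_truncOp_nonneg (h0 : 0 ≤ R) (h1 : R ≤ 1) (ht : 0 ≤ t) (hq : IsSelfAdjoint q) :
    0 ≤ q * truncOp R t * q := by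
  simpa only [hq.star_eq] using star_right_conjugate_nonneg (truncOp_nonneg h0 h1 ht) q

include τ in
theorem dense_range_add_algCompress (hR : IsPosResolvent g R) (hRN : R ∈ N) (hg : Affiliated N g)
    (hqN : q ∈ N) (hq : IsSelfAdjoint q) :
    Dense (Set.range fun x : (algCompress q g).domain => (x : H) + algCompress q g x) := by
  set S := algCompress q g
  let L : Submodule ℂ H := (S.domain.subtype + S.toFun).range
  have hinv : ∀ u ∈ N.commutant, ∀ x ∈ L, u x ∈ L := by
    rintro u hu _ ⟨x, rfl⟩
    obtain ⟨h, hSu⟩ := commutesWith_algCompress (hg u hu) (commute_of_mem_commutant hqN hu) x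
    refine ⟨⟨u x, h⟩, ?_⟩
    change u x + S ⟨u x, h⟩ = u (x + S x)
    rw [hSu, map_add]
  refine τ.dense_of_one_sub_le hR hRN hinv fun k => ?_
  have hk : (0 : ℝ) ≤ k := k.cast_nonneg
  set p := proj (compressCore q R k)
  set b := q * truncOp R k * q
  have hbN : b ∈ N := mul_mem (mul_mem hqN (truncOp_mem hRN k)) hqN
  have hpN : p ∈ N := proj_compressCore_mem hRN hqN
  have hle : ((1 + b) * p).toLinearMap.range ≤ L := by
    rintro _ ⟨x, rfl⟩
    have hx : p x ∈ compressCore q R k := by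
      have hcl : IsClosed (compressCore q R k : Set H) := ContinuousLinearMap.isClosed_ker _
      exact hcl.closure_eq.le (proj_apply_mem_closure _ x)
    obtain ⟨h, hSx⟩ := exists_algCompress_apply_eq hR hk hx
    refine ⟨⟨p x, h⟩, ?_⟩
    change p x + S ⟨p x, h⟩ = (1 + b) (p x)
    rw [hSx, add_apply, one_apply_eq_self]
  calc 1 - τ.re (1 - specProj R k) ≤ τ.re p := τ.one_sub_le_re_proj_compressCore hRN hqN
    _ ≤ τ.re (proj ((1 + b) * p).toLinearMap.range) :=
      τ.re_le_re_proj_range_one_add_mul hbN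
        (conjugate_truncOp_nonneg hR.nonneg hR.le_one hk hq) hpN (isStarProjection_proj _)
    _ ≤ τ.re (proj L) :=
      τ.re_mono (proj_range_mem (mul_mem (add_mem (one_mem N) hbN) hpN)) (proj_mem hinv)
        (proj_mono hle)

include τ in
theorem isEssentiallyPos_algCompress (hgp : IsEssentiallyPos g) (hR : IsPosResolvent g R)
    (hRN : R ∈ N) (hg : Affiliated N g) (hqN : q ∈ N) (hq : IsSelfAdjoint q) :
    IsEssentiallyPos (algCompress q g) where
  dense := dense_domain_algCompress τ hR hRN hg hqN
  symm x y := (hq.isSymmetric.apply_clm _ _).trans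
    ((hgp.symm ⟨q x, x.2⟩ ⟨q y, y.2⟩).trans (hq.isSymmetric.apply_clm _ _))
  nonneg x := by
    rw [algCompress_apply, hq.isSymmetric.apply_clm]
    exact hgp.nonneg ⟨q x, x.2⟩
  dense_range := dense_range_add_algCompress τ hR hRN hg hqN hq

theorem TracialState.exists_isStarProjection_mul_eq {p : H →L[ℂ] H} (hpN : p ∈ N) (heN : e ∈ N)
    (hp : IsStarProjection p) (he : IsStarProjection e) :
    ∃ c ∈ N, IsStarProjection c ∧ p * c = c ∧ e * c = c ∧ τ.re p - τ.re (1 - e) ≤ τ.re c := by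
  have he' : IsStarProjection (1 - e) := he.one_sub
  have hpeN : p * (1 - e) ∈ N := mul_mem hpN (sub_mem (one_mem N) heN)
  set r := proj (p * (1 - e)).toLinearMap.range
  have hr : IsStarProjection r := isStarProjection_proj _
  have hrN : r ∈ N := proj_range_mem hpeN
  have hpr : p * r = r := mul_proj_eq_proj (by
    rintro _ ⟨z, rfl⟩
    exact DFunLike.congr_fun hp.isIdempotentElem.eq ((1 - e) z))
  have hrp : r * p = r := by
    simpa only [star_mul, hr.isSelfAdjoint.star_eq, hp.isSelfAdjoint.star_eq]
      using congrArg star hpr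
  have her : (1 - e) * r = (1 - e) * p := by
    have h := congrArg star (proj_range_mul (p * (1 - e)))
    rwa [star_mul, star_mul, hr.isSelfAdjoint.star_eq, hp.isSelfAdjoint.star_eq,
      he'.isSelfAdjoint.star_eq, mul_assoc, hpr] at h
  refine ⟨p - r, sub_mem hpN hrN, hr.sub_of_mul_eq_left hp hrp, ?_, ?_, ?_⟩
  · rw [mul_sub, hp.isIdempotentElem.eq, hpr]
  · rw [eq_comm, ← sub_eq_zero, ← one_sub_mul, mul_sub, her, sub_self]
  · rw [τ.re_sub hpN hrN]
    have hle : τ.re r ≤ τ.re (1 - e) :=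
      τ.re_proj_range_le hpeN (sub_mem (one_mem N) heN) he' (by
        rw [mul_assoc, he'.isIdempotentElem.eq])
    linarith

theorem smul_le_mul_mul {c : H →L[ℂ] H} (hc : IsStarProjection c) (hb : IsSelfAdjoint b)
    (h : ∀ x, c x = x → s * ‖x‖ ^ 2 ≤ (inner ℂ (b x) x).re) : s • c ≤ c * b * c := by
  have hsa : IsSelfAdjoint (c * b * c) := by
    simpa only [hc.isSelfAdjoint.star_eq] using hb.conjugate c
  rw [ContinuousLinearMap.le_def, ContinuousLinearMap.isPositive_def']
  refine ⟨hsa.sub ((IsSelfAdjoint.all s).smul hc.isSelfAdjoint), fun y => ?_⟩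
  have hcc : c (c y) = c y := DFunLike.congr_fun hc.isIdempotentElem.eq y
  have hinner : ∀ v, inner ℂ (c v) y = inner ℂ v (c y) := fun v =>
    hc.isSelfAdjoint.isSymmetric.apply_clm v y
  have hnorm : (inner ℂ (c y) y).re = ‖c y‖ ^ 2 := by
    rw [← hcc, hinner, hcc]
    exact inner_self_eq_norm_sq (𝕜 := ℂ) _
  change 0 ≤ (inner ℂ (c (b (c y)) - s • c y) y).re
  rw [inner_sub_left, hinner, ← Complex.coe_smul, inner_smul_left, Complex.conj_ofReal,
    Complex.sub_re, Complex.re_ofReal_mul, hnorm, sub_nonneg]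
  exact h (c y) hcc

theorem le_re_inner_truncOp_of_compress (hR : IsPosResolvent g R)
    (hR' : IsPosResolvent (compress q g) R') (hq : IsSelfAdjoint q) (hs : 0 ≤ s) (ht : 0 ≤ t)
    {x : H} (hqx : q x = x) (hgt : specProj R' s x = 0) (hle : specProj R t x = x) :
    s * ‖x‖ ^ 2 ≤ (inner ℂ (truncOp R t x) x).re := by
  have hcore : x ∈ compressCore q R t := by
    change (1 - specProj R t) (q x) = 0
    rw [hqx, sub_apply, one_apply_eq_self, hle, sub_self]
  obtain ⟨hd, hSx⟩ := exists_algCompress_apply_eq hR ht hcore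
  have hext : algCompress q g ≤ compress q g := LinearPMap.le_closure _
  have hTx : compress q g ⟨x, hext.1 hd⟩ = q (truncOp R t x) := by
    rw [← hext.2 (x := ⟨x, hd⟩) rfl, hSx, mul_apply_eq_comp, mul_apply_eq_comp, hqx]
  have h := hR'.le_re_inner hs ⟨x, hext.1 hd⟩ hgt
  rwa [hTx, hq.isSymmetric.apply_clm, hqx] at h

theorem TracialState.mul_re_le_of_compress (hR : IsPosResolvent g R) (hRN : R ∈ N)
    (hR' : IsPosResolvent (compress q g) R') (hq : IsSelfAdjoint q) (hs : 0 ≤ s) (ht : 0 ≤ t)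
    {p : H →L[ℂ] H} (hpN : p ∈ N) (hp : IsStarProjection p) (hqp : q * p = p)
    (hsp : specProj R' s * p = 0) :
    s * τ.re p ≤ τ.re (truncOp R t * p) + s * τ.re (1 - specProj R t) := by
  set a := truncOp R t
  have haN : a ∈ N := truncOp_mem hRN t
  have ha : 0 ≤ a := truncOp_nonneg hR.nonneg hR.le_one ht
  obtain ⟨c, hcN, hc, hpc, hec, hτc⟩ :=
    τ.exists_isStarProjection_mul_eq hpN (specProj_mem hRN t) hp isStarProjection_specProj
  have hcp : c ≤ p := hc.le_of_mul_eq_right hp hpc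
  have hlow : s • c ≤ c * a * c := smul_le_mul_mul hc (.of_nonneg ha) fun x hx => by
    have hpx : p x = x := by rw [← hx, ← mul_apply_eq_comp, hpc]
    refine le_re_inner_truncOp_of_compress hR hR' hq hs ht ?_ ?_ ?_
    · rw [← hpx, ← mul_apply_eq_comp, hqp]
    · rw [← hpx, ← mul_apply_eq_comp, hsp, _root_.zero_apply]
    · rw [← hx, ← mul_apply_eq_comp, hec]
  have hτ : s * τ.re c ≤ τ.re (a * p) :=
    calc s * τ.re c = τ.re (s • c) := (τ.re_smul hcN s).symm
      _ ≤ τ.re (c * a * c) := τ.re_mono (real_smul_mem hcN s) (mul_mem (mul_mem hcN haN) hcN) hlow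
      _ = τ.re (a * c) := by
        rw [mul_assoc, τ.re_mul_comm hcN (mul_mem haN hcN), mul_assoc, hc.isIdempotentElem.eq]
      _ ≤ τ.re (a * p) := τ.re_mul_mono_right hcN hpN haN hcp ha
  linarith [mul_le_mul_of_nonneg_left hτc hs]

theorem TracialState.ofReal_mul_re_le_iSup (hR : IsPosResolvent g R) (hRN : R ∈ N)
    (hR' : IsPosResolvent (compress q g) R') (hq : IsSelfAdjoint q) (hs : 0 ≤ s)
    {p : H →L[ℂ] H} (hpN : p ∈ N) (hp : IsStarProjection p) (hqp : q * p = p)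
    (hsp : specProj R' s * p = 0) :
    ENNReal.ofReal (s * τ.re p) ≤ ⨆ k : ℕ, ENNReal.ofReal (τ.re (truncOp R k * p)) := by
  set X := ⨆ k : ℕ, ENNReal.ofReal (τ.re (truncOp R k * p))
  have hlim : Tendsto (fun k : ℕ => X + ENNReal.ofReal (s * τ.re (1 - specProj R k))) atTop
      (𝓝 X) := by
    simpa only [mul_zero, ENNReal.ofReal_zero, add_zero] using
      tendsto_const_nhds.add (ENNReal.tendsto_ofReal
        ((τ.tendsto_re_one_sub_specProj hRN hR.nonneg
          hR.isResolvent.injective).const_mul s))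
  refine ge_of_tendsto hlim (.of_forall fun k => ?_)
  refine (ENNReal.ofReal_le_ofReal
    (τ.mul_re_le_of_compress hR hRN hR' hq hs k.cast_nonneg hpN hp hqp hsp)).trans
    (ENNReal.ofReal_add_le.trans ?_)
  gcongr
  exact le_iSup (fun k : ℕ => ENNReal.ofReal (τ.re (truncOp R k * p))) k

end Compress

namespace TracialState.MemL1Pos

variable {N M : VonNeumannAlgebra H} {τ : TracialState N} {g : H →ₗ.[ℂ] H}

section Compress

variable (hg : τ.MemL1Pos M g) (hM : M ≤ N) {q : H →L[ℂ] H} (hqM : q ∈ M) (hq : IsStarProjection q)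

include hg hM hqM hq

theorem exists_isPosResolvent_compress :
    ∃ R ∈ M, IsPosResolvent (compress q g) R ∧ Commute q R := by
  obtain ⟨R, hRM, hR⟩ := hg.exists_isPosResolvent
  have hS := isEssentiallyPos_algCompress τ hg.isEssentiallyPos hR (hM hRM)
    (fun u hu => hg.affiliated u (mem_commutant_of_le hM hu)) (hM hqM) hq.isSelfAdjoint
  refine ⟨coreResolvent (algCompress q g), mem_of_forall_commute fun u hu => ?_,
    ⟨hS.isResolvent_closure, hS.coreResolvent_nonneg, hS.coreResolvent_le_one⟩,
    hS.commute_coreResolvent (commutesWith_algCompress_self hq.isIdempotentElem)⟩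
  exact hS.commute_coreResolvent (commutesWith_algCompress (hg.affiliated u hu)
    (commute_of_mem_commutant hqM hu))

theorem spectralLE_compress_mem (s : ℝ) : spectralLE (compress q g) s ∈ M := by
  obtain ⟨R, hRM, hR, -⟩ := hg.exists_isPosResolvent_compress hM hqM hq
  rw [hR.spectralLE_eq]
  exact specProj_mem hRM s

theorem commute_spectralLE_compress (s : ℝ) : Commute q (spectralLE (compress q g) s) := by
  obtain ⟨R, -, hR, hqR⟩ := hg.exists_isPosResolvent_compress hM hqM hq
  rw [hR.spectralLE_eq]
  exact commute_specProj hqR (by rwa [hq.isSelfAdjoint.star_eq]) s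

theorem isStarProjection_mul_one_sub_spectralLE (s : ℝ) :
    IsStarProjection (q * (1 - spectralLE (compress q g) s)) :=
  hq.mul (isStarProjection_proj _).one_sub
    ((Commute.one_right q).sub_right (hg.commute_spectralLE_compress hM hqM hq s))

theorem ofReal_mul_re_le_traceMul {s : ℝ} (hs : 0 ≤ s) :
    ENNReal.ofReal (s * τ.re (q * (1 - spectralLE (compress q g) s)))
      ≤ τ.traceMul g (q * (1 - spectralLE (compress q g) s)) := by
  obtain ⟨R, hRM, hR⟩ := hg.exists_isPosResolvent
  obtain ⟨R', hRM', hR', -⟩ := hg.exists_isPosResolvent_compress hM hqM hq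
  have hc := hg.commute_spectralLE_compress hM hqM hq s
  have hp := hg.isStarProjection_mul_one_sub_spectralLE hM hqM hq s
  rw [hR.traceMul_eq]
  rw [hR'.spectralLE_eq] at hc hp ⊢
  refine τ.ofReal_mul_re_le_iSup hR (hM hRM) hR' hq.isSelfAdjoint hs
    (hM (mul_mem hqM (sub_mem (one_mem M) (specProj_mem hRM' s)))) hp ?_ ?_
  · rw [← mul_assoc, hq.isIdempotentElem.eq]
  · rw [← mul_assoc, ← hc.eq, mul_assoc, isStarProjection_specProj.mul_one_sub_self, mul_zero]

end Compress

theorem traceMul_add (hg : τ.MemL1Pos N g) {x y : H →L[ℂ] H} (hx : x ∈ N) (hx0 : 0 ≤ x)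
    (hy : y ∈ N) (hy0 : 0 ≤ y) : τ.traceMul g (x + y) = τ.traceMul g x + τ.traceMul g y := by
  have hφ := hg.isNormalPositive_l1Functional
  rw [hg.traceMul_eq_ofReal (add_mem hx hy) (add_nonneg hx0 hy0), hg.traceMul_eq_ofReal hx hx0,
    hg.traceMul_eq_ofReal hy hy0, hφ.map_add hx hy,
    ENNReal.ofReal_add (hφ.nonneg hx hx0) (hφ.nonneg hy hy0)]

theorem traceMul_le (hg : τ.MemL1Pos N g) {P : H →L[ℂ] H} (hPN : P ∈ N) (hP : IsStarProjection P)
    {t : ℝ} (ht : 0 ≤ t) :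
    τ.traceMul g P ≤ ENNReal.ofReal (t * τ.re P) + τ.traceMul g (spectralGT g t) := by
  obtain ⟨R, hRN, hR⟩ := hg.exists_isPosResolvent
  rw [spectralGT, hR.spectralLE_eq, hR.traceMul_eq, hR.traceMul_eq]
  refine iSup_le fun k => ?_
  set a := truncOp R k
  set e := specProj R t
  have ha : 0 ≤ a := truncOp_nonneg hR.nonneg hR.le_one k.cast_nonneg
  have haN : a ∈ N := truncOp_mem hRN k
  have heN : e ∈ N := specProj_mem hRN t
  have haeN : a * (1 - e) ∈ N := mul_mem haN (sub_mem (one_mem N) heN)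
  have hae : 0 ≤ a * (1 - e) :=
    ((Commute.one_right a).sub_right (commute_truncOp_specProj hR.isSelfAdjoint k t)).mul_nonneg
      ha isStarProjection_specProj.one_sub.nonneg
  have hlow : τ.re (a * e * P) ≤ t * τ.re P := by
    have h := τ.re_mul_mono_left (mul_mem haN heN) (real_smul_mem (one_mem N) t) hPN
      (truncOp_mul_specProj_le hR.nonneg k.cast_nonneg ht) hP.nonneg
    rwa [smul_mul_assoc, one_mul, τ.re_smul hPN] at h
  have hhigh : τ.re (a * (1 - e) * P) ≤ τ.re (a * (1 - e)) := by
    simpa only [mul_one] using τ.re_mul_mono_right hPN (one_mem N) haeN hP.le_one hae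
  calc ENNReal.ofReal (τ.re (a * P))
      = ENNReal.ofReal (τ.re (a * e * P) + τ.re (a * (1 - e) * P)) := by
        rw [← τ.re_add (mul_mem (mul_mem haN heN) hPN) (mul_mem haeN hPN), ← add_mul, ← mul_add,
          add_sub_cancel, mul_one]
    _ ≤ ENNReal.ofReal (t * τ.re P) + ENNReal.ofReal (τ.re (a * (1 - e))) :=
        (ENNReal.ofReal_le_ofReal (add_le_add hlow hhigh)).trans ENNReal.ofReal_add_le
    _ ≤ _ := by
        gcongr
        exact le_iSup (fun k : ℕ => ENNReal.ofReal (τ.re (truncOp R k * (1 - e)))) k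

end TracialState.MemL1Pos

theorem tendsto_proj_iInf {K : ℕ → Submodule ℂ H} (hK : Antitone K)
    (hc : ∀ n, IsClosed (K n : Set H)) (x : H) :
    Tendsto (fun n => proj (K n) x) atTop (𝓝 (proj (⨅ n, K n) x)) := by
  have hproj : ∀ L : Submodule ℂ H, proj L x = x - Lᗮ.starProjection x := fun L => by
    have h := DFunLike.congr_fun L.topologicalClosure.starProjection_orthogonal' x
    simp only [Submodule.orthogonal_closure, sub_apply, one_apply_eq_self] at h
    rw [h, sub_sub_cancel, proj]
  have hsup : (⨆ n, (K n)ᗮ).topologicalClosure = (⨅ n, K n)ᗮ := by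
    rw [← Submodule.orthogonal_orthogonal_eq_closure, ← Submodule.iInf_orthogonal]
    simp only [Submodule.orthogonal_orthogonal_eq_closure, (hc _).submodule_topologicalClosure_eq]
  simp only [hproj]
  have h := Submodule.starProjection_tendsto_closure_iSup (fun n => (K n)ᗮ)
    (fun _ _ hmn => Submodule.orthogonal_le (hK hmn)) x
  simp only [hsup] at h
  exact h.const_sub x

theorem ofReal_le_two_div_mul {s x : ℝ} {X : ℝ≥0∞} (hs : 0 < s) (hx : 0 ≤ x)
    (h : ENNReal.ofReal (s * x) ≤ ENNReal.ofReal (s / 2 * x) + X) :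
    ENNReal.ofReal x ≤ 2 / ENNReal.ofReal s * X := by
  have hhalf : ENNReal.ofReal (s / 2 * x) ≤ X := by
    have hsplit : s * x = s / 2 * x + s / 2 * x := by ring
    rw [hsplit, ENNReal.ofReal_add (by positivity) (by positivity)] at h
    exact (ENNReal.add_le_add_iff_left ENNReal.ofReal_ne_top).1 h
  have htwo : (2 : ℝ≥0∞) / ENNReal.ofReal s = ENNReal.ofReal (2 / s) := by
    rw [ENNReal.ofReal_div_of_pos hs, ENNReal.ofReal_ofNat]
  have hscale : x = 2 / s * (s / 2 * x) := by field_simp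
  rw [hscale, ENNReal.ofReal_mul (by positivity), htwo]
  gcongr

section Cuculescu

variable {N : VonNeumannAlgebra H} {τ : TracialState N} {F : ℕ → VonNeumannAlgebra H}
  {f : H →ₗ.[ℂ] H} {g : ℕ → H →ₗ.[ℂ] H} {s : ℝ}

theorem cuculescuSeq_mem_and_isStarProjection (hmono : Monotone F) (hle : ∀ n, F n ≤ N)
    (hg : ∀ n, τ.MemL1Pos (F n) (g n)) (s : ℝ) (n : ℕ) :
    cuculescuSeq g s n ∈ F n ∧ IsStarProjection (cuculescuSeq g s n) := by
  induction n with
  | zero => exact ⟨one_mem _, .one _⟩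
  | succ n ih =>
    obtain ⟨hqn, hq⟩ := ih
    have hq' : cuculescuSeq g s n ∈ F (n + 1) := hmono n.le_succ hqn
    exact ⟨mul_mem hq' ((hg _).spectralLE_compress_mem (hle _) hq' hq s),
      hq.mul (isStarProjection_proj _) ((hg _).commute_spectralLE_compress (hle _) hq' hq s)⟩

theorem antitone_cuculescuSeq (hq : ∀ n, IsStarProjection (cuculescuSeq g s n)) :
    Antitone (cuculescuSeq g s) := antitone_nat_of_succ_le fun n => by
  refine (hq (n + 1)).le_of_mul_eq_right (hq n) ?_
  rw [cuculescuSeq, ← mul_assoc, (hq n).isIdempotentElem.eq]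

/- The projection `q n - q (n + 1)` lies in `F (n + 1)`, so on it the trace of `g (n + 1)` is that
of `f`, and the contributions of the steps add up. -/
theorem ofReal_mul_re_one_sub_cuculescuSeq_le (hmono : Monotone F) (hle : ∀ n, F n ≤ N)
    (hf : τ.MemL1Pos N f) (hg : ∀ n, τ.IsCondExp (F n) f (g n)) (hs : 0 ≤ s) (n : ℕ) :
    ENNReal.ofReal (s * τ.re (1 - cuculescuSeq g s n))
      ≤ τ.traceMul f (1 - cuculescuSeq g s n) := by
  induction n with
  | zero =>
    have h : τ.re (1 - cuculescuSeq g s 0) = 0 := by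
      rw [cuculescuSeq, τ.re_sub (one_mem N) (one_mem N), sub_self]
    rw [h, mul_zero, ENNReal.ofReal_zero]
    exact zero_le
  | succ n ih =>
    obtain ⟨hqF, hq⟩ :=
      cuculescuSeq_mem_and_isStarProjection hmono hle (fun n => (hg n).1) s n
    have hq' : cuculescuSeq g s n ∈ F (n + 1) := hmono n.le_succ hqF
    have hpF := (hg (n + 1)).1.spectralLE_compress_mem (hle _) hq' hq s
    have hp := (hg (n + 1)).1.isStarProjection_mul_one_sub_spectralLE (hle _) hq' hq s
    have hstep := (hg (n + 1)).1.ofReal_mul_re_le_traceMul (hle _) hq' hq hs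
    rw [cuculescuSeq]
    set q := cuculescuSeq g s n
    set e := spectralLE (compress q (g (n + 1))) s
    have hqeF : q * (1 - e) ∈ F (n + 1) := mul_mem hq' (sub_mem (one_mem _) hpF)
    have hqN : 1 - q ∈ N := sub_mem (one_mem N) (hle n hqF)
    have hdecomp : 1 - q * e = (1 - q) + q * (1 - e) := by
      rw [mul_sub, mul_one, sub_add_sub_cancel]
    rw [(hg (n + 1)).2 _ hqeF hp.nonneg] at hstep
    rw [hdecomp, hf.traceMul_add hqN hq.one_sub.nonneg (hle _ hqeF) hp.nonneg,
      τ.re_add hqN (hle _ hqeF), mul_add]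
    exact ENNReal.ofReal_add_le.trans (add_le_add ih hstep)

theorem ofReal_re_one_sub_cuculescuSeq_le (hmono : Monotone F) (hle : ∀ n, F n ≤ N)
    (hf : τ.MemL1Pos N f) (hg : ∀ n, τ.IsCondExp (F n) f (g n)) (hs : 0 < s) (n : ℕ) :
    ENNReal.ofReal (τ.re (1 - cuculescuSeq g s n))
      ≤ 2 / ENNReal.ofReal s * τ.traceMul f (spectralGT f (s / 2)) := by
  obtain ⟨hqF, hq⟩ := cuculescuSeq_mem_and_isStarProjection hmono hle (fun n => (hg n).1) s n
  have hqN : 1 - cuculescuSeq g s n ∈ N := sub_mem (one_mem N) (hle n hqF)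
  exact ofReal_le_two_div_mul hs (τ.re_nonneg hqN hq.one_sub.nonneg)
    ((ofReal_mul_re_one_sub_cuculescuSeq_le hmono hle hf hg hs.le n).trans
      (hf.traceMul_le hqN hq.one_sub (half_pos hs).le))

theorem proj_iInf_range_mem {q : ℕ → H →L[ℂ] H} (hq : ∀ n, q n ∈ N) :
    proj (⨅ n, (q n).toLinearMap.range) ∈ N := by
  refine proj_mem fun u hu x hx => ?_
  rw [Submodule.mem_iInf] at hx ⊢
  intro n
  obtain ⟨z, rfl⟩ := hx n
  exact ⟨u z, (DFunLike.congr_fun (commute_of_mem_commutant (hq n) hu).eq z).symm⟩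

theorem tendsto_re_one_sub_cuculescuSeq (hq : ∀ n, cuculescuSeq g s n ∈ N)
    (hproj : ∀ n, IsStarProjection (cuculescuSeq g s n)) :
    Tendsto (fun n => τ.re (1 - cuculescuSeq g s n)) atTop
      (𝓝 (τ.re (1 - proj (⨅ n, (cuculescuSeq g s n).toLinearMap.range)))) := by
  set q := cuculescuSeq g s
  have hrange : ∀ n, proj (q n).toLinearMap.range = q n := fun n =>
    proj_range_of_isStarProjection (hproj n)
  have hanti : Antitone fun n => (q n).toLinearMap.range := fun m n hmn => by
    rintro _ ⟨x, rfl⟩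
    exact ⟨q n x, DFunLike.congr_fun
      (((hproj n).le_iff_mul_eq_right (hproj m)).1 (antitone_cuculescuSeq hproj hmn)) x⟩
  have hlim := tendsto_proj_iInf hanti fun n =>
    ContinuousLinearMap.IsIdempotentElem.isClosed_range (hproj n).isIdempotentElem
  simp only [hrange] at hlim
  have hmem : proj (⨅ n, (q n).toLinearMap.range) ∈ N := proj_iInf_range_mem hq
  simp only [τ.re_sub (one_mem N) hmem, τ.re_sub (one_mem N) (hq _)]
  exact (τ.tendsto_re hq hmem (fun n => IsStarProjection.norm_le _ (hproj n)) hlim).const_sub _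

end Cuculescu

end NCMart

end

theorem mainTheorem7 {H : Type*} [NormedAddCommGroup H] [InnerProductSpace ℂ H] [CompleteSpace H]
    (N : VonNeumannAlgebra H) (τ : NCMart.TracialState N)
    (F : ℕ → VonNeumannAlgebra H) (hmono : Monotone F) (hle : ∀ n, F n ≤ N)
    (f : H →ₗ.[ℂ] H) (hf : τ.MemL1Pos N f) (s : ℝ) (hs : 0 < s) :
    ∃ hq : 1 - τ.cuculescu F f s ∈ N.toStarSubalgebra,
      ENNReal.ofReal (τ.toLinearMap ⟨1 - τ.cuculescu F f s, hq⟩).re ≤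
        2 / ENNReal.ofReal s * τ.traceMul f (NCMart.spectralGT f (s / 2)) := by
  have hcond : ∀ n, τ.IsCondExp (F n) f (τ.condExp (F n) f) := fun n => hf.isCondExp_condExp (hle n)
  have hseq := NCMart.cuculescuSeq_mem_and_isStarProjection hmono hle (fun n => (hcond n).1) s
  have hmem : 1 - τ.cuculescu F f s ∈ N :=
    sub_mem (one_mem N) (NCMart.proj_iInf_range_mem fun n => hle n (hseq n).1)
  have hlim := NCMart.tendsto_re_one_sub_cuculescuSeq (τ := τ) (fun n => hle n (hseq n).1)
    fun n => (hseq n).2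
  refine ⟨hmem, ?_⟩
  rw [← τ.re_of_mem hmem]
  exact le_of_tendsto' (ENNReal.tendsto_ofReal hlim)
    (NCMart.ofReal_re_one_sub_cuculescuSeq_le hmono hle hf hcond hs)
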